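/- Let $K$ be a field. For a $K$-coalgebra $C$ let $\mathbf M^C$ be the category of right $C$-comodules; $C$ is called right semiperfect if $\mathbf M^C$ has enough projectives. A comodule $M\in\mathbf M^C$ is called quasi-finite if the functor $-\otimes M:\mathrm{Vect}_K\to\mathbf M^C$ has a left adjoint, which is then denoted $H_C(M,-)$. For a coalgebra morphism $\alpha:C\to D$ let $\alpha^*:\mathbf M^C\to\mathbf M^D$, $(M,\rho)\mapsto(M,(\mathrm{id}\otimes\alpha)\rho)$, be the corestriction functor. If $C=\alpha^*C$ is quasi-finite as a right $D$-comodule, then $H_D(C,N)$ is naturally a right $C$-comodule for every $N\in\mathbf M^D$, and $\alpha^!:=H_D(C,-):\mathbf M^D\to\mathbf M^C$ is left adjoint to $\alpha^*$; in this situation $\alpha$ is called $\Sigma$-injective if the direct sum $C^{(\Lambda)}$ is an injective right $D$-comodule for every set $\Lambda$ (equivalently, $\alpha^!$ is exact). Let $\mathscr X$ be a poset, regarded as a small category, and let $\mathcal C:\mathscr X\to\mathrm{Coalg}_K$ be a functor such that each $\mathcal C_x$ is right semiperfect and such that, for each morphism $\alpha:x\to y$ of $\mathscr X$, the morphism $\mathcal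 C_\alpha:\mathcal C_x\to\mathcal C_y$ makes $\mathcal C_x$ a quasi-finite right $\mathcal C_y$-comodule and is $\Sigma$-injective. Write $\alpha^*,\alpha^!$ for $(\mathcal C_\alpha)^*,(\mathcal C_\alpha)^!$. A trans-comodule $\mathcal M$ over $\mathcal C$ consists of a right $\mathcal C_x$-comodule $\mathcal M_x$ for each $x\in\mathscr X$ and a morphism ${}_\alpha\mathcal M:\mathcal M_y\to\alpha^*\mathcal M_x$ in $\mathbf M^{\mathcal C_y}$ for each $\alpha:x\to y$, equivalently a morphism ${}^\alpha\mathcal M:\alpha^!\mathcal M_y\to\mathcal M_x$ in $\mathbf M^{\mathcal C_x}$, such that ${}_{\mathrm{id}_x}\mathcal M=\mathrm{id}$ and ${}_{\beta\alpha}\mathcal M=\beta^*({}_\alpha\mathcal M)\circ{}_\beta\mathcal M$ for all $x\xrightarrow{\alpha}y\xrightarrow{\beta}z$. A morphism $\eta:\mathcal M\to\mathcal N$ is a family of morphisms $\eta_x:\mathcal M_x\to\mathcal N_x$ in $\mathbf M^{\mathcal C_x}$ with $\alpha^*(\eta_x)\circ{}_\alpha\mathcal M={}_\alpha\mathcal N\circ\eta_y$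 for each $\alpha:x\to y$. The trans-comodule $\mathcal M$ is cartesian if ${}^\alpha\mathcal M:\alpha^!\mathcal M_y\to\mathcal M_x$ is an isomorphism for each $\alpha:x\to y$. Then the full subcategory $Com^{tr}_c\text{-}\mathcal C$ of cartesian trans-comodules is a Grothendieck category (an abelian category with exact filtered colimits and a generator). -/

import Mathlib

open CategoryTheory TensorProduct

universe u

noncomputable section

/-! ### Linear algebra identities used to build comodules -/

namespace ComodAux

variable {K : Type u} [Field K]
variable {C : Type u} [AddCommGroup C] [Module K C]
variable {D : Type u} [AddCommGroup D] [Module K D]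
variable {M : Type u} [AddCommGroup M] [Module K M]
variable {N : Type u} [AddCommGroup N] [Module K N]
variable {V : Type u} [AddCommGroup V] [Module K V]

theorem assoc_lTensor (f : C →ₗ[K] D) (ρ : M →ₗ[K] M ⊗[K] C) (t : M ⊗[K] C) :
    TensorProduct.assoc K M D D ((f.lTensor M ∘ₗ ρ).rTensor D (f.lTensor M t)) =
      (TensorProduct.map f f).lTensor M (TensorProduct.assoc K M C C (ρ.rTensor C t)) := by
  induction t using TensorProduct.induction_on with
  | zero => simp only [map_zero]
  | add a b ha hb => simp only [map_add, ha, hb]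
  | tmul m c =>
    simp only [LinearMap.lTensor_tmul, LinearMap.rTensor_tmul, LinearMap.comp_apply]
    induction ρ m using TensorProduct.induction_on with
    | zero => simp only [map_zero, TensorProduct.zero_tmul]
    | add a b ha hb => simp only [map_add, TensorProduct.add_tmul, ha, hb]
    | tmul a b => simp only [LinearMap.lTensor_tmul, TensorProduct.assoc_tmul,
        TensorProduct.map_tmul]

theorem assoc_tmul_left (v : V) (s : M ⊗[K] C) (c : C) :
    TensorProduct.assoc K (V ⊗[K] M) C C
        ((TensorProduct.assoc K V M C).symm (v ⊗ₜ[K] s) ⊗ₜ[K] c) =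
      (TensorProduct.assoc K V M (C ⊗[K] C)).symm
        (v ⊗ₜ[K] TensorProduct.assoc K M C C (s ⊗ₜ[K] c)) := by
  induction s using TensorProduct.induction_on with
  | zero => simp only [map_zero, TensorProduct.zero_tmul, TensorProduct.tmul_zero]
  | add a b ha hb =>
    simp only [map_add, TensorProduct.add_tmul, TensorProduct.tmul_add, ha, hb]
  | tmul a b => simp only [TensorProduct.assoc_symm_tmul, TensorProduct.assoc_tmul]

theorem assoc_tensor (ρ : M →ₗ[K] M ⊗[K] C) (v : V) (t : M ⊗[K] C) :
    TensorProduct.assoc K (V ⊗[K] M) C C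
        (((TensorProduct.assoc K V M C).symm.toLinearMap ∘ₗ ρ.lTensor V).rTensor C
          ((TensorProduct.assoc K V M C).symm (v ⊗ₜ[K] t))) =
      (TensorProduct.assoc K V M (C ⊗[K] C)).symm
        (v ⊗ₜ[K] TensorProduct.assoc K M C C (ρ.rTensor C t)) := by
  induction t using TensorProduct.induction_on with
  | zero => simp only [map_zero, TensorProduct.tmul_zero]
  | add a b ha hb => simp only [map_add, TensorProduct.tmul_add, ha, hb]
  | tmul m c =>
    simp only [TensorProduct.assoc_symm_tmul, LinearMap.lTensor_tmul, LinearMap.rTensor_tmul,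
      LinearMap.comp_apply, LinearEquiv.coe_coe]
    exact assoc_tmul_left v (ρ m) c

theorem lTensor_assoc_symm (f : C →ₗ[K] D) (v : V) (t : M ⊗[K] C) :
    f.lTensor (V ⊗[K] M) ((TensorProduct.assoc K V M C).symm (v ⊗ₜ[K] t)) =
      (TensorProduct.assoc K V M D).symm (v ⊗ₜ[K] f.lTensor M t) := by
  induction t using TensorProduct.induction_on with
  | zero => simp only [map_zero, TensorProduct.tmul_zero]
  | add a b ha hb => simp only [map_add, TensorProduct.tmul_add, ha, hb]
  | tmul m c => simp only [TensorProduct.assoc_symm_tmul, LinearMap.lTensor_tmul]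

theorem lTensor_assoc_symm' (f : C →ₗ[K] D) (t : V ⊗[K] (M ⊗[K] C)) :
    f.lTensor (V ⊗[K] M) ((TensorProduct.assoc K V M C).symm t) =
      (TensorProduct.assoc K V M D).symm ((f.lTensor M).lTensor V t) := by
  induction t using TensorProduct.induction_on with
  | zero => simp only [map_zero]
  | add a b ha hb => simp only [map_add, ha, hb]
  | tmul v s => rw [lTensor_assoc_symm, LinearMap.lTensor_tmul]

theorem rTensor_assoc_symm (f : V →ₗ[K] N) (v : V) (t : M ⊗[K] C) :
    (f.rTensor M).rTensor C ((TensorProduct.assoc K V M C).symm (v ⊗ₜ[K] t)) =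
      (TensorProduct.assoc K N M C).symm (f v ⊗ₜ[K] t) := by
  induction t using TensorProduct.induction_on with
  | zero => simp only [map_zero, TensorProduct.tmul_zero]
  | add a b ha hb => simp only [map_add, TensorProduct.tmul_add, ha, hb]
  | tmul m c => simp only [TensorProduct.assoc_symm_tmul, LinearMap.rTensor_tmul]

theorem rTensor_assoc_symm' (f : V →ₗ[K] N) (t : V ⊗[K] (M ⊗[K] C)) :
    (f.rTensor M).rTensor C ((TensorProduct.assoc K V M C).symm t) =
      (TensorProduct.assoc K N M C).symm (f.rTensor (M ⊗[K] C) t) := by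
  induction t using TensorProduct.induction_on with
  | zero => simp only [map_zero]
  | add a b ha hb => simp only [map_add, ha, hb]
  | tmul v s => rw [rTensor_assoc_symm, LinearMap.rTensor_tmul]

theorem rid_lTensor_natural (g : V →ₗ[K] N) (ε : C →ₗ[K] K) (t : V ⊗[K] C) :
    g (TensorProduct.rid K V (ε.lTensor V t)) =
      TensorProduct.rid K N (ε.lTensor N (g.rTensor C t)) := by
  induction t using TensorProduct.induction_on with
  | zero => simp only [map_zero]
  | add a b ha hb => simp only [map_add, ha, hb]
  | tmul v c => simp only [LinearMap.lTensor_tmul, LinearMap.rTensor_tmul, TensorProduct.rid_tmul,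
      map_smul]

theorem assoc_rTensor_rTensor (i : M →ₗ[K] N) (t : (M ⊗[K] C) ⊗[K] D) :
    TensorProduct.assoc K N C D ((i.rTensor C).rTensor D t) =
      i.rTensor (C ⊗[K] D) (TensorProduct.assoc K M C D t) := by
  induction t using TensorProduct.induction_on with
  | zero => simp only [map_zero]
  | add a b ha hb => simp only [map_add, ha, hb]
  | tmul s c =>
    induction s using TensorProduct.induction_on with
    | zero => simp only [map_zero, TensorProduct.zero_tmul]
    | add a b ha hb => simp only [map_add, TensorProduct.add_tmul, ha, hb]
    | tmul a b => simp only [TensorProduct.assoc_tmul, LinearMap.rTensor_tmul]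

theorem lTensor_rTensor (f : C →ₗ[K] D) (i : M →ₗ[K] N) (t : M ⊗[K] C) :
    f.lTensor N (i.rTensor C t) = i.rTensor D (f.lTensor M t) := by
  induction t using TensorProduct.induction_on with
  | zero => simp only [map_zero]
  | add a b ha hb => simp only [map_add, ha, hb]
  | tmul a b => simp only [LinearMap.lTensor_tmul, LinearMap.rTensor_tmul]

theorem tensor_map (f : V →ₗ[K] N) (ρ : M →ₗ[K] M ⊗[K] C) (t : V ⊗[K] M) :
    ((TensorProduct.assoc K N M C).symm.toLinearMap ∘ₗ ρ.lTensor N) (f.rTensor M t) =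
      (f.rTensor M).rTensor C
        (((TensorProduct.assoc K V M C).symm.toLinearMap ∘ₗ ρ.lTensor V) t) := by
  induction t using TensorProduct.induction_on with
  | zero => simp only [map_zero]
  | add a b ha hb => simp only [map_add, ha, hb]
  | tmul v m =>
    have e : ((TensorProduct.assoc K V M C).symm.toLinearMap ∘ₗ ρ.lTensor V) (v ⊗ₜ[K] m) =
      (TensorProduct.assoc K V M C).symm (v ⊗ₜ[K] ρ m) := rfl
    rw [e, rTensor_assoc_symm, LinearMap.rTensor_tmul]
    rfl

/-- The coaction on a direct sum of copies of `M`. -/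
def sumCoact (Λ : Type u) (ρ : M →ₗ[K] M ⊗[K] C) : (Λ →₀ M) →ₗ[K] (Λ →₀ M) ⊗[K] C :=
  Finsupp.lsum K fun i => (Finsupp.lsingle i).rTensor C ∘ₗ ρ

theorem sumCoact_single (Λ : Type u) (ρ : M →ₗ[K] M ⊗[K] C) (i : Λ) (m : M) :
    sumCoact Λ ρ (Finsupp.single i m) = (Finsupp.lsingle (R := K) i).rTensor C (ρ m) := by
  rw [sumCoact, Finsupp.lsum_single, LinearMap.comp_apply]

variable [Coalgebra K C]

theorem corestrict_coassoc [Coalgebra K D] (α : C →ₗc[K] D) (ρ : M →ₗ[K] M ⊗[K] C)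
    (h : ∀ m, TensorProduct.assoc K M C C (ρ.rTensor C (ρ m)) =
      (Coalgebra.comul (R := K) (A := C)).lTensor M (ρ m)) (m : M) :
    TensorProduct.assoc K M D D ((α.toLinearMap.lTensor M ∘ₗ ρ).rTensor D
        ((α.toLinearMap.lTensor M ∘ₗ ρ) m)) =
      (Coalgebra.comul (R := K) (A := D)).lTensor M ((α.toLinearMap.lTensor M ∘ₗ ρ) m) := by
  rw [LinearMap.comp_apply (α.toLinearMap.lTensor M) ρ m, assoc_lTensor α.toLinearMap ρ (ρ m), h m,
    ← LinearMap.lTensor_comp_apply, ← LinearMap.lTensor_comp_apply, α.map_comp_comul]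

theorem corestrict_counit [Coalgebra K D] (α : C →ₗc[K] D) (ρ : M →ₗ[K] M ⊗[K] C)
    (h : ∀ m, (Coalgebra.counit (R := K) (A := C)).lTensor M (ρ m) = m ⊗ₜ[K] (1 : K)) (m : M) :
    (Coalgebra.counit (R := K) (A := D)).lTensor M ((α.toLinearMap.lTensor M ∘ₗ ρ) m) =
      m ⊗ₜ[K] (1 : K) := by
  rw [LinearMap.comp_apply (α.toLinearMap.lTensor M) ρ m, ← LinearMap.lTensor_comp_apply,
    α.counit_comp, h m]

theorem tensor_coassoc (V : Type u) [AddCommGroup V] [Module K V] (ρ : M →ₗ[K] M ⊗[K] C)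
    (h : ∀ m, TensorProduct.assoc K M C C (ρ.rTensor C (ρ m)) =
      (Coalgebra.comul (R := K) (A := C)).lTensor M (ρ m)) (t : V ⊗[K] M) :
    TensorProduct.assoc K (V ⊗[K] M) C C
        (((TensorProduct.assoc K V M C).symm.toLinearMap ∘ₗ ρ.lTensor V).rTensor C
          (((TensorProduct.assoc K V M C).symm.toLinearMap ∘ₗ ρ.lTensor V) t)) =
      (Coalgebra.comul (R := K) (A := C)).lTensor (V ⊗[K] M)
        (((TensorProduct.assoc K V M C).symm.toLinearMap ∘ₗ ρ.lTensor V) t) := by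
  induction t using TensorProduct.induction_on with
  | zero => simp only [map_zero]
  | add a b ha hb => simp only [map_add, ha, hb]
  | tmul v m =>
    have e : ((TensorProduct.assoc K V M C).symm.toLinearMap ∘ₗ ρ.lTensor V) (v ⊗ₜ[K] m) =
      (TensorProduct.assoc K V M C).symm (v ⊗ₜ[K] ρ m) := rfl
    rw [e, assoc_tensor, lTensor_assoc_symm, h]

theorem tensor_counit (V : Type u) [AddCommGroup V] [Module K V] (ρ : M →ₗ[K] M ⊗[K] C)
    (h : ∀ m, (Coalgebra.counit (R := K) (A := C)).lTensor M (ρ m) = m ⊗ₜ[K] (1 : K))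
    (t : V ⊗[K] M) :
    (Coalgebra.counit (R := K) (A := C)).lTensor (V ⊗[K] M)
        (((TensorProduct.assoc K V M C).symm.toLinearMap ∘ₗ ρ.lTensor V) t) = t ⊗ₜ[K] (1 : K) := by
  induction t using TensorProduct.induction_on with
  | zero => simp only [map_zero, TensorProduct.zero_tmul]
  | add a b ha hb => simp only [map_add, TensorProduct.add_tmul, ha, hb]
  | tmul v m =>
    have e : ((TensorProduct.assoc K V M C).symm.toLinearMap ∘ₗ ρ.lTensor V) (v ⊗ₜ[K] m) =
      (TensorProduct.assoc K V M C).symm (v ⊗ₜ[K] ρ m) := rfl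
    rw [e, lTensor_assoc_symm, h, TensorProduct.assoc_symm_tmul]

theorem sum_coassoc (Λ : Type u) (ρ : M →ₗ[K] M ⊗[K] C)
    (h : ∀ m, TensorProduct.assoc K M C C (ρ.rTensor C (ρ m)) =
      (Coalgebra.comul (R := K) (A := C)).lTensor M (ρ m)) (t : Λ →₀ M) :
    TensorProduct.assoc K (Λ →₀ M) C C ((sumCoact Λ ρ).rTensor C (sumCoact Λ ρ t)) =
      (Coalgebra.comul (R := K) (A := C)).lTensor (Λ →₀ M) (sumCoact Λ ρ t) := by
  induction t using Finsupp.induction_linear with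
  | zero => simp only [map_zero]
  | add a b ha hb => simp only [map_add, ha, hb]
  | single i m =>
    have e : sumCoact Λ ρ ∘ₗ Finsupp.lsingle i = (Finsupp.lsingle (R := K) i).rTensor C ∘ₗ ρ :=
      LinearMap.ext fun a => sumCoact_single Λ ρ i a
    rw [sumCoact_single, lTensor_rTensor, ← h, ← assoc_rTensor_rTensor,
      ← LinearMap.rTensor_comp_apply, ← LinearMap.rTensor_comp_apply, e]

theorem sum_counit (Λ : Type u) (ρ : M →ₗ[K] M ⊗[K] C)
    (h : ∀ m, (Coalgebra.counit (R := K) (A := C)).lTensor M (ρ m) = m ⊗ₜ[K] (1 : K))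
    (t : Λ →₀ M) :
    (Coalgebra.counit (R := K) (A := C)).lTensor (Λ →₀ M) (sumCoact Λ ρ t) = t ⊗ₜ[K] (1 : K) := by
  induction t using Finsupp.induction_linear with
  | zero => simp only [map_zero, TensorProduct.zero_tmul]
  | add a b ha hb => simp only [map_add, TensorProduct.add_tmul, ha, hb]
  | single i m =>
    rw [sumCoact_single, lTensor_rTensor, h, LinearMap.rTensor_tmul, Finsupp.lsingle_apply]

variable (K C) in
/-- The map `V ⊗ C → (V ⊗ C) ⊗ C` given by the comultiplication of `C`. -/
def delta (V : Type u) [AddCommGroup V] [Module K V] : V ⊗[K] C →ₗ[K] (V ⊗[K] C) ⊗[K] C :=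
  (TensorProduct.assoc K V C C).symm.toLinearMap ∘ₗ
    (Coalgebra.comul (R := K) (A := C)).lTensor V

theorem delta_apply (t : V ⊗[K] C) : delta K C V t =
    (TensorProduct.assoc K V C C).symm ((Coalgebra.comul (R := K) (A := C)).lTensor V t) := rfl

theorem delta_natural (g : V →ₗ[K] N) (t : V ⊗[K] C) :
    (g.rTensor C).rTensor C (delta K C V t) = delta K C N (g.rTensor C t) := by
  rw [delta_apply, delta_apply, rTensor_assoc_symm', lTensor_rTensor]

theorem rTensor_delta (ρ : M →ₗ[K] M ⊗[K] C)
    (h : ∀ m, TensorProduct.assoc K M C C (ρ.rTensor C (ρ m)) =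
      (Coalgebra.comul (R := K) (A := C)).lTensor M (ρ m)) (m : M) :
    ρ.rTensor C (ρ m) = delta K C M (ρ m) := by
  rw [delta_apply, ← h, LinearEquiv.symm_apply_apply]

theorem delta_coassoc (t : V ⊗[K] C) :
    (TensorProduct.assoc K V C C).toLinearMap.rTensor C
        (delta K C (V ⊗[K] C) (delta K C V t)) =
      ((Coalgebra.comul (R := K) (A := C)).lTensor V).rTensor C (delta K C V t) := by
  have h1 : ∀ (v : V) (s : C ⊗[K] C), (TensorProduct.assoc K V C C).toLinearMap.rTensor C
      (delta K C (V ⊗[K] C) ((TensorProduct.assoc K V C C).symm (v ⊗ₜ[K] s))) =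
      (TensorProduct.assoc K V (C ⊗[K] C) C).symm
        (v ⊗ₜ[K] (TensorProduct.assoc K C C C).symm
          ((Coalgebra.comul (R := K) (A := C)).lTensor C s)) := by
    intro v s
    induction s using TensorProduct.induction_on with
    | zero => simp only [map_zero, TensorProduct.tmul_zero]
    | add a b ha hb => simp only [map_add, TensorProduct.tmul_add, ha, hb]
    | tmul a b =>
      simp only [TensorProduct.assoc_symm_tmul, delta_apply, LinearMap.lTensor_tmul]
      induction Coalgebra.comul (R := K) b using TensorProduct.induction_on with
      | zero => simp only [map_zero, TensorProduct.tmul_zero]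
      | add a b ha hb => simp only [map_add, TensorProduct.tmul_add, ha, hb]
      | tmul x y =>
        simp only [TensorProduct.assoc_symm_tmul, LinearMap.rTensor_tmul, LinearEquiv.coe_coe,
          TensorProduct.assoc_tmul]
  have h2 : ∀ (v : V) (s : C ⊗[K] C),
      ((Coalgebra.comul (R := K) (A := C)).lTensor V).rTensor C
        ((TensorProduct.assoc K V C C).symm (v ⊗ₜ[K] s)) =
      (TensorProduct.assoc K V (C ⊗[K] C) C).symm
        (v ⊗ₜ[K] (Coalgebra.comul (R := K) (A := C)).rTensor C s) := by
    intro v s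
    induction s using TensorProduct.induction_on with
    | zero => simp only [map_zero, TensorProduct.tmul_zero]
    | add a b ha hb => simp only [map_add, TensorProduct.tmul_add, ha, hb]
    | tmul a b =>
      simp only [TensorProduct.assoc_symm_tmul, LinearMap.lTensor_tmul, LinearMap.rTensor_tmul]
  induction t using TensorProduct.induction_on with
  | zero => simp only [map_zero]
  | add a b ha hb => simp only [map_add, ha, hb]
  | tmul v c =>
    have e : delta K C V (v ⊗ₜ[K] c) =
      (TensorProduct.assoc K V C C).symm (v ⊗ₜ[K] Coalgebra.comul (R := K) c) := rfl
    rw [e, h1, h2, Coalgebra.coassoc_symm_apply]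

theorem rTensor_lTensor_counit_delta (t : V ⊗[K] C) :
    ((Coalgebra.counit (R := K) (A := C)).lTensor V).rTensor C (delta K C V t) =
      ((TensorProduct.mk K V K).flip 1).rTensor C t := by
  have h2 : ∀ (v : V) (s : C ⊗[K] C),
      ((Coalgebra.counit (R := K) (A := C)).lTensor V).rTensor C
        ((TensorProduct.assoc K V C C).symm (v ⊗ₜ[K] s)) =
      (TensorProduct.assoc K V K C).symm
        (v ⊗ₜ[K] (Coalgebra.counit (R := K) (A := C)).rTensor C s) := by
    intro v s
    induction s using TensorProduct.induction_on with
    | zero => simp only [map_zero, TensorProduct.tmul_zero]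
    | add a b ha hb => simp only [map_add, TensorProduct.tmul_add, ha, hb]
    | tmul a b =>
      simp only [TensorProduct.assoc_symm_tmul, LinearMap.lTensor_tmul, LinearMap.rTensor_tmul]
  induction t using TensorProduct.induction_on with
  | zero => simp only [map_zero]
  | add a b ha hb => simp only [map_add, ha, hb]
  | tmul v c =>
    have e : delta K C V (v ⊗ₜ[K] c) =
      (TensorProduct.assoc K V C C).symm (v ⊗ₜ[K] Coalgebra.comul (R := K) c) := rfl
    rw [e, h2, Coalgebra.rTensor_counit_comul, TensorProduct.assoc_symm_tmul,
      LinearMap.rTensor_tmul, LinearMap.flip_apply, TensorProduct.mk_apply]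

theorem rid_lTensor_counit_delta (t : V ⊗[K] C) :
    TensorProduct.rid K (V ⊗[K] C)
      ((Coalgebra.counit (R := K) (A := C)).lTensor (V ⊗[K] C) (delta K C V t)) = t := by
  rw [delta, tensor_counit V _ Coalgebra.lTensor_counit_comul, TensorProduct.rid_tmul, one_smul]

theorem coactHom_comm (f : C →ₗ[K] D) (ρ : M →ₗ[K] M ⊗[K] C)
    (h : ∀ m, TensorProduct.assoc K M C C (ρ.rTensor C (ρ m)) =
      (Coalgebra.comul (R := K) (A := C)).lTensor M (ρ m)) (m : M) :
    (TensorProduct.assoc K M C D).symm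
        ((f.lTensor C ∘ₗ Coalgebra.comul (R := K) (A := C)).lTensor M (ρ m)) =
      ρ.rTensor D (f.lTensor M (ρ m)) := by
  rw [LinearMap.lTensor_comp_apply, ← lTensor_assoc_symm', ← delta_apply, ← rTensor_delta ρ h,
    lTensor_rTensor]

theorem lTensor_delta (f : C →ₗ[K] D) (t : V ⊗[K] C) :
    f.lTensor (V ⊗[K] C) (delta K C V t) = (TensorProduct.assoc K V C D).symm
      ((f.lTensor C ∘ₗ Coalgebra.comul (R := K) (A := C)).lTensor V t) := by
  rw [LinearMap.lTensor_comp_apply, ← lTensor_assoc_symm', ← delta_apply]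

theorem rid_counit (ρ : M →ₗ[K] M ⊗[K] C)
    (h : ∀ m, (Coalgebra.counit (R := K) (A := C)).lTensor M (ρ m) = m ⊗ₜ[K] (1 : K)) (m : M) :
    TensorProduct.rid K M ((Coalgebra.counit (R := K) (A := C)).lTensor M (ρ m)) = m := by
  rw [h, TensorProduct.rid_tmul, one_smul]

theorem rid_counit_tensor (f : C →ₗ[K] D) (t : V ⊗[K] C) :
    ((TensorProduct.rid K V).toLinearMap ∘ₗ
        (Coalgebra.counit (R := K) (A := C)).lTensor V).rTensor D
      ((TensorProduct.assoc K V C D).symm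
        ((f.lTensor C ∘ₗ Coalgebra.comul (R := K) (A := C)).lTensor V t)) = f.lTensor V t := by
  rw [LinearMap.lTensor_comp_apply, ← lTensor_assoc_symm', ← delta_apply, ← lTensor_rTensor,
    LinearMap.rTensor_comp_apply, rTensor_lTensor_counit_delta, ← LinearMap.rTensor_comp_apply]
  have e : (TensorProduct.rid K V).toLinearMap ∘ₗ (TensorProduct.mk K V K).flip 1 =
      LinearMap.id := LinearMap.ext fun v => by simp
  rw [e, LinearMap.rTensor_id, LinearMap.id_apply]

end ComodAux

/-! ### Right comodules over a coalgebra -/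

/-- A right comodule over the `K`-coalgebra `C`: a `K`-vector space `M` with a coassociative and
counital coaction `ρ : M → M ⊗ C`. -/
structure RightComod (K : Type u) [Field K] (C : Type u) [AddCommGroup C] [Module K C]
    [Coalgebra K C] : Type (u + 1) where
  carrier : Type u
  [addCommGroup : AddCommGroup carrier]
  [module : Module K carrier]
  /-- the coaction -/
  coact : carrier →ₗ[K] carrier ⊗[K] C
  coassoc : ∀ m : carrier,
    TensorProduct.assoc K carrier C C (coact.rTensor C (coact m)) =
      (Coalgebra.comul (R := K) (A := C)).lTensor carrier (coact m)
  lTensor_counit_coact : ∀ m : carrier,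
    (Coalgebra.counit (R := K) (A := C)).lTensor carrier (coact m) = m ⊗ₜ[K] (1 : K)

namespace RightComod

instance (K : Type u) [Field K] (C : Type u) [AddCommGroup C] [Module K C] [Coalgebra K C] :
    CoeSort (RightComod K C) (Type u) := ⟨RightComod.carrier⟩

attribute [instance] RightComod.addCommGroup RightComod.module

variable {K : Type u} [Field K]
variable {C : Type u} [AddCommGroup C] [Module K C] [Coalgebra K C]
variable {D : Type u} [AddCommGroup D] [Module K D] [Coalgebra K D]

/-- Morphisms of right comodules: the `K`-linear maps compatible with the coactions. -/
@[ext]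
structure Hom (M N : RightComod K C) : Type u where
  toLin : M →ₗ[K] N
  comm : ∀ m : M, N.coact (toLin m) = toLin.rTensor C (M.coact m)

/-- The category `𝐌^C` of right `C`-comodules. -/
instance category : Category.{u} (RightComod K C) where
  Hom M N := Hom M N
  id M := { toLin := LinearMap.id, comm := fun m => by simp }
  comp f g :=
    { toLin := g.toLin ∘ₗ f.toLin
      comm := fun m => by
        rw [LinearMap.comp_apply, g.comm, f.comm, LinearMap.rTensor_comp_apply] }

@[ext]
theorem hom_ext {M N : RightComod K C} {f g : M ⟶ N} (h : f.toLin = g.toLin) : f = g :=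
  Hom.ext h

@[simp]
theorem id_toLin (M : RightComod K C) : Hom.toLin (𝟙 M) = LinearMap.id := rfl

@[simp]
theorem comp_toLin {M N P : RightComod K C} (f : M ⟶ N) (g : N ⟶ P) :
    (f ≫ g).toLin = g.toLin ∘ₗ f.toLin := rfl

variable (K C) in
/-- The coalgebra `C` as a right comodule over itself. -/
abbrev regular : RightComod K C where
  carrier := C
  coact := Coalgebra.comul
  coassoc := Coalgebra.coassoc_apply
  lTensor_counit_coact := Coalgebra.lTensor_counit_comul

/-- The corestriction `α^* M = (M, (id ⊗ α) ∘ ρ^M)` of a right `C`-comodule `M = (M, ρ^M)` along a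
morphism of coalgebras `α : C → D`. -/
abbrev corestrictObj (α : C →ₗc[K] D) (M : RightComod K C) : RightComod K D where
  carrier := M.carrier
  addCommGroup := M.addCommGroup
  module := M.module
  coact := α.toLinearMap.lTensor M.carrier ∘ₗ M.coact
  coassoc := ComodAux.corestrict_coassoc α M.coact M.coassoc
  lTensor_counit_coact := ComodAux.corestrict_counit α M.coact M.lTensor_counit_coact

/-- The corestriction functor `α^* : 𝐌^C ⥤ 𝐌^D` of a morphism of coalgebras `α : C → D`; it does
not change the underlying linear maps. -/
abbrev corestrict (α : C →ₗc[K] D) : RightComod K C ⥤ RightComod K D where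
  obj M := corestrictObj α M
  map {M N} f :=
    { toLin := f.toLin
      comm := fun m => (congrArg (α.toLinearMap.lTensor N.carrier) (f.comm m)).trans
        (ComodAux.lTensor_rTensor α.toLinearMap f.toLin (M.coact m)) }

/-- The right comodule `V ⊗ M` with coaction `id_V ⊗ ρ^M`, for a vector space `V` and a right
comodule `M`. -/
abbrev tensorObj (M : RightComod K C) (V : Type u) [AddCommGroup V] [Module K V] :
    RightComod K C where
  carrier := V ⊗[K] M.carrier
  addCommGroup := TensorProduct.addCommGroup
  module := TensorProduct.instModule
  coact := (TensorProduct.assoc K V M.carrier C).symm.toLinearMap ∘ₗ M.coact.lTensor V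
  coassoc := ComodAux.tensor_coassoc V M.coact M.coassoc
  lTensor_counit_coact := ComodAux.tensor_counit V M.coact M.lTensor_counit_coact

/-- The tensor functor `- ⊗ M : Vect ⥤ 𝐌^C` of a right `C`-comodule `M`. -/
abbrev tensorFunctor (M : RightComod K C) : ModuleCat.{u} K ⥤ RightComod K C where
  obj V := tensorObj M V
  map f :=
    { toLin := f.hom.rTensor M.carrier
      comm := ComodAux.tensor_map f.hom M.coact }
  map_id V := hom_ext (LinearMap.rTensor_id M.carrier V)
  map_comp f g := hom_ext (LinearMap.rTensor_comp M.carrier g.hom f.hom)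

/-- The direct sum `M^(Λ)` of copies of a right comodule `M`. -/
def directSum (M : RightComod K C) (Λ : Type u) : RightComod K C where
  carrier := Λ →₀ M.carrier
  addCommGroup := inferInstance
  module := inferInstance
  coact := ComodAux.sumCoact Λ M.coact
  coassoc := ComodAux.sum_coassoc Λ M.coact M.coassoc
  lTensor_counit_coact := ComodAux.sum_counit Λ M.coact M.lTensor_counit_coact

/-- A right comodule `M` is quasi-finite if `- ⊗ M : Vect ⥤ 𝐌^C` has a left adjoint. -/
class IsQuasiFinite (M : RightComod K C) : Prop where
  isRightAdjoint : (tensorFunctor M).IsRightAdjoint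

attribute [instance] IsQuasiFinite.isRightAdjoint

/-- The functor `H_C(M, -) : 𝐌^C ⥤ Vect`, left adjoint to `- ⊗ M`. -/
def cohom (M : RightComod K C) [IsQuasiFinite M] : RightComod K C ⥤ ModuleCat.{u} K :=
  (tensorFunctor M).leftAdjoint

/-- The adjunction between `H_C(M, -)` and `- ⊗ M`. -/
def cohomAdj (M : RightComod K C) [IsQuasiFinite M] : cohom M ⊣ tensorFunctor M :=
  Adjunction.ofIsRightAdjoint _

/-- `C` as a right `D`-comodule, through a morphism of coalgebras `α : C → D`. -/
abbrev overCod (α : C →ₗc[K] D) : RightComod K D := (corestrict α).obj (regular K C)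

/-- The coaction of a right `C`-comodule `W`, as a morphism `α^* W ⟶ W ⊗ C` of right
`D`-comodules. -/
def coactHom (α : C →ₗc[K] D) (W : RightComod K C) :
    (corestrict α).obj W ⟶ (tensorFunctor (overCod α)).obj (ModuleCat.of K W.carrier) where
  toLin := W.coact
  comm := ComodAux.coactHom_comm α.toLinearMap W.coact W.coassoc

/-- The map `V ⊗ C → (V ⊗ C) ⊗ C` is a morphism of right `D`-comodules. -/
def deltaHom (α : C →ₗc[K] D) (V : ModuleCat.{u} K) :
    (tensorFunctor (overCod α)).obj V ⟶
      (tensorFunctor (overCod α)).obj (ModuleCat.of K (V ⊗[K] C)) where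
  toLin := ComodAux.delta K C V
  comm t := by
    have h := (coactHom α (tensorObj (regular K C) V)).comm t
    refine h.trans (congrArg ((ComodAux.delta K C V).rTensor D) ?_)
    exact ComodAux.lTensor_delta α.toLinearMap t

section Shriek

variable (α : C →ₗc[K] D) [IsQuasiFinite (overCod α)]

/-- The unit `N → H_D(C, N) ⊗ C`. -/
def coev (N : RightComod K D) : N.carrier →ₗ[K] ((cohom (overCod α)).obj N) ⊗[K] C :=
  ((cohomAdj (overCod α)).unit.app N).toLin

variable {α}

/-- The linear map `H_D(C, N) → V` corresponding to a morphism `N ⟶ V ⊗ C`. -/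
def lift {N : RightComod K D} {V : ModuleCat.{u} K} (f : N ⟶ (tensorFunctor (overCod α)).obj V) :
    (cohom (overCod α)).obj N →ₗ[K] V :=
  (((cohomAdj (overCod α)).homEquiv N V).symm f).hom

theorem lift_coev {N : RightComod K D} {V : ModuleCat.{u} K}
    (f : N ⟶ (tensorFunctor (overCod α)).obj V) (n : N.carrier) :
    (lift f).rTensor C (coev α N n) = f.toLin n := by
  have h := ((cohomAdj (overCod α)).homEquiv_unit N V
    (((cohomAdj (overCod α)).homEquiv N V).symm f)).symm
  rw [Equiv.apply_symm_apply] at h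
  exact LinearMap.congr_fun (congrArg Hom.toLin h) n

theorem cohom_ext {N : RightComod K D} {V : Type u} [AddCommGroup V] [Module K V]
    {g g' : (cohom (overCod α)).obj N →ₗ[K] V}
    (h : ∀ n, g.rTensor C (coev α N n) = g'.rTensor C (coev α N n)) : g = g' := by
  have h' : ModuleCat.ofHom g = ModuleCat.ofHom g' := by
    apply ((cohomAdj (overCod α)).homEquiv N (ModuleCat.of K V)).injective
    rw [Adjunction.homEquiv_unit, Adjunction.homEquiv_unit]
    exact hom_ext (LinearMap.ext h)
  exact congrArg ModuleCat.Hom.hom h'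

variable (α)

/-- The coaction of `C` on `H_D(C, N)`: the unique linear map `ρ` with
`(ρ ⊗ id) ∘ η = (id ⊗ Δ) ∘ η`, where `η : N → H_D(C, N) ⊗ C` is the unit. -/
def shriekCoact (N : RightComod K D) :
    (cohom (overCod α)).obj N →ₗ[K] ((cohom (overCod α)).obj N) ⊗[K] C :=
  lift ((cohomAdj (overCod α)).unit.app N ≫ deltaHom α ((cohom (overCod α)).obj N))

theorem shriekCoact_coev (N : RightComod K D) (n : N.carrier) :
    (shriekCoact α N).rTensor C (coev α N n) = ComodAux.delta K C _ (coev α N n) :=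
  lift_coev ((cohomAdj (overCod α)).unit.app N ≫ deltaHom α ((cohom (overCod α)).obj N)) n

/-- The right `C`-comodule `α^! N = H_D(C, N)`. -/
def shriekObj (N : RightComod K D) : RightComod K C where
  carrier := (cohom (overCod α)).obj N
  addCommGroup := inferInstance
  module := inferInstance
  coact := shriekCoact α N
  coassoc := by
    refine LinearMap.congr_fun (f := (TensorProduct.assoc K _ C C).toLinearMap ∘ₗ
      (shriekCoact α N).rTensor C ∘ₗ shriekCoact α N)
      (g := (Coalgebra.comul (R := K) (A := C)).lTensor _ ∘ₗ shriekCoact α N)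
      (cohom_ext fun n => ?_)
    rw [LinearMap.rTensor_comp_apply, LinearMap.rTensor_comp_apply, LinearMap.rTensor_comp_apply,
      shriekCoact_coev, ComodAux.delta_natural, shriekCoact_coev, ComodAux.delta_coassoc]
  lTensor_counit_coact := by
    refine LinearMap.congr_fun
      (f := (Coalgebra.counit (R := K) (A := C)).lTensor _ ∘ₗ shriekCoact α N)
      (g := (TensorProduct.mk K _ K).flip 1)
      (cohom_ext fun n => ?_)
    rw [LinearMap.rTensor_comp_apply, shriekCoact_coev, ComodAux.rTensor_lTensor_counit_delta]

/-- The unit `N ⟶ α^* α^! N`. -/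
def shriekUnit (N : RightComod K D) : N ⟶ (corestrict α).obj (shriekObj α N) where
  toLin := ((TensorProduct.rid K _).toLinearMap ∘ₗ
    (Coalgebra.counit (R := K) (A := C)).lTensor _) ∘ₗ coev α N
  comm n := by
    have h := ((cohomAdj (overCod α)).unit.app N).comm n
    change (TensorProduct.assoc K _ C D).symm
      ((α.toLinearMap.lTensor C ∘ₗ Coalgebra.comul (R := K) (A := C)).lTensor _ (coev α N n)) =
        (coev α N).rTensor D (N.coact n) at h
    change α.toLinearMap.lTensor _ (shriekCoact α N (TensorProduct.rid K _
      ((Coalgebra.counit (R := K) (A := C)).lTensor _ (coev α N n)))) =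
      (((TensorProduct.rid K _).toLinearMap ∘ₗ
        (Coalgebra.counit (R := K) (A := C)).lTensor _) ∘ₗ coev α N).rTensor D (N.coact n)
    rw [LinearMap.rTensor_comp_apply, ← h, ComodAux.rid_counit_tensor,
      ComodAux.rid_lTensor_natural, shriekCoact_coev, ComodAux.rid_lTensor_counit_delta]

theorem shriekCoact_unit (N : RightComod K D) (n : N.carrier) :
    shriekCoact α N ((shriekUnit α N).toLin n) = coev α N n := by
  change shriekCoact α N (TensorProduct.rid K _
      ((Coalgebra.counit (R := K) (A := C)).lTensor _ (coev α N n))) = _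
  rw [ComodAux.rid_lTensor_natural, shriekCoact_coev, ComodAux.rid_lTensor_counit_delta]

/-- The morphism `α^! N ⟶ W` of right `C`-comodules corresponding to a morphism `N ⟶ α^* W`. -/
def shriekDesc (N : RightComod K D) (W : RightComod K C) (f : N ⟶ (corestrict α).obj W) :
    shriekObj α N ⟶ W where
  toLin := lift (f ≫ coactHom α W)
  comm := by
    refine LinearMap.congr_fun (f := W.coact ∘ₗ lift (f ≫ coactHom α W))
      (g := (lift (f ≫ coactHom α W)).rTensor C ∘ₗ shriekCoact α N) (cohom_ext fun n => ?_)
    have h : (lift (f ≫ coactHom α W)).rTensor C (coev α N n) = W.coact (f.toLin n) :=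
      lift_coev (f ≫ coactHom α W) n
    rw [LinearMap.rTensor_comp_apply, LinearMap.rTensor_comp_apply, shriekCoact_coev,
      ComodAux.delta_natural]
    erw [h]
    exact ComodAux.rTensor_delta W.coact W.coassoc (f.toLin n)

/-- The bijection `𝐌^C(α^! N, W) ≃ 𝐌^D(N, α^* W)`. -/
def shriekHomEquiv (N : RightComod K D) (W : RightComod K C) :
    (shriekObj α N ⟶ W) ≃ (N ⟶ (corestrict α).obj W) where
  toFun g := shriekUnit α N ≫ (corestrict α).map g
  invFun f := shriekDesc α N W f
  left_inv g := by
    apply hom_ext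
    refine cohom_ext fun n => ?_
    refine (lift_coev ((shriekUnit α N ≫ (corestrict α).map g) ≫ coactHom α W) n).trans ?_
    refine (g.comm ((shriekUnit α N).toLin n)).trans ?_
    exact congrArg (g.toLin.rTensor C) (shriekCoact_unit α N n)
  right_inv f := by
    apply hom_ext
    refine LinearMap.ext fun n => ?_
    refine (ComodAux.rid_lTensor_natural (lift (f ≫ coactHom α W)) Coalgebra.counit
      (coev α N n)).trans ?_
    have h : (lift (f ≫ coactHom α W)).rTensor C (coev α N n) = W.coact (f.toLin n) :=
      lift_coev (f ≫ coactHom α W) n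
    refine (congrArg (fun t => TensorProduct.rid K _
      ((Coalgebra.counit (R := K) (A := C)).lTensor _ t)) h).trans ?_
    exact ComodAux.rid_counit W.coact W.lTensor_counit_coact (f.toLin n)

/-- The functor `α^! = H_D(C, -) : 𝐌^D ⥤ 𝐌^C`. -/
def shriek : RightComod K D ⥤ RightComod K C :=
  Adjunction.leftAdjointOfEquiv (G := corestrict α) (shriekHomEquiv α) fun _ _ _ _ _ => rfl

/-- `α^!` is left adjoint to the corestriction functor `α^*`. -/
def shriekAdj : shriek α ⊣ corestrict α :=
  Adjunction.adjunctionOfEquivLeft (G := corestrict α) (shriekHomEquiv α) fun _ _ _ _ _ => rfl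

end Shriek

/-- A coalgebra morphism `α : C → D` is (right) `Σ`-injective if the direct sum `C^(Λ)` is injective
as a right `D`-comodule, for every index set `Λ`. -/
def IsSigmaInjective (α : C →ₗc[K] D) : Prop :=
  ∀ Λ : Type u, Injective (directSum (overCod α) Λ)

/-- A coalgebra `C` is right semiperfect if the category of right `C`-comodules has enough
projectives. -/
def IsRightSemiperfect (K : Type u) [Field K] (C : Type u) [AddCommGroup C] [Module K C]
    [Coalgebra K C] : Prop :=
  EnoughProjectives (RightComod K C)

end RightComod

/-! ### Trans-comodules over a coalgebra representation -/

section Representation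

variable {K : Type u} [Field K] {X : Type u} [Category.{u} X]

/-- A right trans-comodule `M` over a coalgebra representation `𝒞 : X ⥤ Coalg`: a right
`𝒞_x`-comodule `M_x` for every object `x`, and a morphism `_αM : M_y ⟶ α^* M_x` of right
`𝒞_y`-comodules for every `α : x ⟶ y`, with `_{id}M = id` and `_{βα}M = β^*(_αM) ∘ _βM`. -/
structure TransComod (𝒞 : X ⥤ CoalgCat.{u} K) : Type (u + 1) where
  obj (x : X) : RightComod K (𝒞.obj x)
  map {x y : X} (α : x ⟶ y) :
    obj y ⟶ (RightComod.corestrict (𝒞.map α).toCoalgHom).obj (obj x)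
  map_id (x : X) (m : (obj x).carrier) : (map (𝟙 x)).toLin m = m
  map_comp {x y z : X} (α : x ⟶ y) (β : y ⟶ z) (m : (obj z).carrier) :
    (map (α ≫ β)).toLin m = (map α).toLin ((map β).toLin m)

namespace TransComod

/-- A morphism of trans-comodules: morphisms `η_x : M_x ⟶ N_x` of right `𝒞_x`-comodules compatible
with the structure morphisms. -/
@[ext]
structure Hom {𝒞 : X ⥤ CoalgCat.{u} K} (M N : TransComod 𝒞) : Type u where
  app (x : X) : M.obj x ⟶ N.obj x
  naturality {x y : X} (α : x ⟶ y) :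
    M.map α ≫ (RightComod.corestrict (𝒞.map α).toCoalgHom).map (app x) = app y ≫ N.map α

/-- The category `Com^{tr}-𝒞` of right trans-comodules over `𝒞`. -/
instance category {𝒞 : X ⥤ CoalgCat.{u} K} : Category.{u} (TransComod 𝒞) where
  Hom M N := Hom M N
  id M :=
    { app := fun x => 𝟙 (M.obj x)
      naturality := fun α => by
        rw [CategoryTheory.Functor.map_id, Category.comp_id, Category.id_comp] }
  comp f g :=
    { app := fun x => f.app x ≫ g.app x
      naturality := fun α => by
        rw [CategoryTheory.Functor.map_comp, ← Category.assoc, f.naturality, Category.assoc,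
          g.naturality, Category.assoc] }

end TransComod

/-- A coalgebra representation is quasi-finite if `𝒞_α : 𝒞_x → 𝒞_y` makes `𝒞_x` a quasi-finite right
`𝒞_y`-comodule, for every `α : x ⟶ y`. -/
class IsQuasiFiniteRep (𝒞 : X ⥤ CoalgCat.{u} K) : Prop where
  isQuasiFinite {x y : X} (α : x ⟶ y) :
    RightComod.IsQuasiFinite (RightComod.overCod (𝒞.map α).toCoalgHom)

attribute [instance] IsQuasiFiniteRep.isQuasiFinite

/-- A coalgebra representation is `Σ`-injective if every `𝒞_α : 𝒞_x → 𝒞_y` is `Σ`-injective. -/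
def IsSigmaInjectiveRep (𝒞 : X ⥤ CoalgCat.{u} K) : Prop :=
  ∀ ⦃x y : X⦄ (α : x ⟶ y), RightComod.IsSigmaInjective (𝒞.map α).toCoalgHom

namespace TransComod

variable {𝒞 : X ⥤ CoalgCat.{u} K} [IsQuasiFiniteRep 𝒞]

/-- The morphism `^αM : α^! M_y ⟶ M_x` of right `𝒞_x`-comodules corresponding to
`_αM : M_y ⟶ α^* M_x` under the adjunction between `α^!` and `α^*`. -/
def shriekMap (M : TransComod 𝒞) {x y : X} (α : x ⟶ y) :
    (RightComod.shriek (𝒞.map α).toCoalgHom).obj (M.obj y) ⟶ M.obj x :=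
  ((RightComod.shriekAdj (𝒞.map α).toCoalgHom).homEquiv (M.obj y) (M.obj x)).symm (M.map α)

variable (𝒞) in
/-- A trans-comodule `M` is cartesian if `^αM : α^! M_y ⟶ M_x` is an isomorphism for every
`α : x ⟶ y`. -/
def IsCartesian : ObjectProperty (TransComod 𝒞) :=
  fun M => ∀ ⦃x y : X⦄ (α : x ⟶ y), IsIso (M.shriekMap α)

variable (𝒞) in
/-- The category `Com^{tr}_c-𝒞`: the full subcategory of cartesian trans-comodules. -/
abbrev Cartesian : Type (u + 1) := (IsCartesian 𝒞).FullSubcategory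

end TransComod

end Representation

end

/-!
Forgetting the coactions and the structure morphisms is a conservative functor from trans-comodules
to families of vector spaces, and kernels and colimits are computed on underlying spaces. So
trans-comodules inherit an abelian structure and exact filtered colimits from vector spaces.

The morphism `^αM : α^! M_y ⟶ M_x` is natural in `M`. Since `α^!` is a left adjoint, cartesian
trans-comodules are closed under colimits. If `α` is `Σ`-injective, then `- ⊗ C` preserves injective
objects, so its left adjoint `α^!` preserves monomorphisms and is therefore exact; hence cartesian
trans-comodules are closed under kernels too, and they inherit the same two properties.

For a separator, every element of a cartesian `M` lies in a cartesian sub-trans-comodule of bounded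
size. The coaction of one element involves finitely many elements, and an element of `M_x` is the
image under `^αM` of an element of `α^! M_y` that already comes from finitely many elements of
`M_y`. Closing up under these choices and under the structure morphisms gives generators indexed by
words in a fixed alphabet. A trans-comodule so generated is determined up to isomorphism by the
relations between its generators, and the possible relations form a set.
-/

noncomputable section

open Limits

section Conservative

variable {A : Type*} [Category* A] [Preadditive A] {B : Type*} [Category* B] [Abelian B]
  (U : A ⥤ B) [U.ReflectsIsomorphisms]
  [∀ {M N : A} (f : M ⟶ N), PreservesLimit (parallelPair f 0) U]

/-- The abelian structure on a preadditive category with a conservative functor to an abelian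
category that preserves kernels and cokernels: the comparison from coimages to images is invertible
because its image is. -/
abbrev abelianOfReflectsIsomorphisms [HasFiniteProducts A] [HasKernels A] [HasCokernels A]
    [U.PreservesZeroMorphisms] [∀ {M N : A} (f : M ⟶ N), PreservesColimit (parallelPair f 0) U] :
    Abelian A := by
  have {M N : A} (f : M ⟶ N) : IsIso (Abelian.coimageImageComparison f) := by
    have : IsIso (U.map (Abelian.coimageImageComparison f)) := by
      rw [Arrow.isIso_iff_isIso_of_isIso (Abelian.PreservesCoimageImageComparison.iso U f).hom]
      infer_instance
    exact isIso_of_reflects_iso _ U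
  exact Abelian.ofCoimageImageComparisonIsIso

theorem ab5OfSize_of_reflectsIsomorphisms [U.Additive] [HasFiniteBiproducts A]
    [HasEqualizers A] [HasColimitsOfSize.{u, u} A] [PreservesColimitsOfSize.{u, u} U]
    [HasFilteredColimitsOfSize.{u, u} B] [AB5OfSize.{u, u} B] : AB5OfSize.{u, u} A := by
  have := hasBinaryBiproducts_of_finite_biproducts A
  have : HasFiniteLimits A := hasFiniteLimits_of_hasEqualizers_and_finite_products
  have : PreservesFiniteLimits U := U.preservesFiniteLimits_of_preservesKernels
  exact ⟨fun J _ _ => HasExactColimitsOfShape.domain_of_functor J U⟩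

end Conservative

theorem preservesKernel_comp {A B D : Type*} [Category* A] [HasZeroMorphisms A] [Category* B]
    [HasZeroMorphisms B] [Category* D] (F : A ⥤ B) (G : B ⥤ D) [F.PreservesZeroMorphisms]
    {M N : A} (f : M ⟶ N) [PreservesLimit (parallelPair f 0) F]
    [PreservesLimit (parallelPair (F.map f) 0) G] : PreservesLimit (parallelPair f 0) (F ⋙ G) :=
  have : PreservesLimit (parallelPair f 0 ⋙ F) G :=
    preservesLimit_of_iso_diagram (K₁ := parallelPair (F.map f) 0) G
      (parallelPair.ext (Iso.refl _) (Iso.refl _) (by simp) (by simp))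
  comp_preservesLimit F G

theorem isIso_app_conePt_of_preservesLimit {A B J : Type*} [Category* A] [Category* B]
    [Category* J] {F : J ⥤ A} {L L' : A ⥤ B} (τ : L ⟶ L') [IsIso (Functor.whiskerLeft F τ)]
    {c : Cone F} (hc : IsLimit c) [PreservesLimit F L] [PreservesLimit F L'] :
    IsIso (τ.app c.pt) := by
  let e := IsLimit.conePointsIsoOfNatIso (isLimitOfPreserves L hc) (isLimitOfPreserves L' hc)
    (asIso (Functor.whiskerLeft F τ))
  suffices h : e.hom = τ.app c.pt from h ▸ inferInstance
  refine (isLimitOfPreserves L' hc).hom_ext fun j => ?_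
  exact (IsLimit.conePointsIsoOfNatIso_hom_comp _ _ _ j).trans (τ.naturality (c.π.app j))

namespace RightComod

variable {K : Type u} [Field K] {C : Type u} [AddCommGroup C] [Module K C]

variable (C) in
theorem rTensor_subtype_injective {V : Type u} [AddCommGroup V] [Module K V]
    (p : Submodule K V) : Function.Injective (p.subtype.rTensor C) :=
  Module.Flat.rTensor_preserves_injective_linearMap _ p.injective_subtype

theorem exists_finite_mem_range_rTensor {V : Type u} [AddCommGroup V] [Module K V] (t : V ⊗[K] C) :
    ∃ T : Set V, T.Finite ∧
      ∀ p : Submodule K V, T ⊆ p → t ∈ LinearMap.range (p.subtype.rTensor C) := by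
  obtain ⟨S, rfl⟩ := TensorProduct.exists_finset t
  refine ⟨Prod.fst '' (S : Set (V × C)), S.finite_toSet.image _, fun p hp => ?_⟩
  exact Submodule.sum_mem _ fun a ha => ⟨⟨a.1, hp ⟨a, ha, rfl⟩⟩ ⊗ₜ a.2, rfl⟩

/-- Contraction of the second tensor factor with a linear form. -/
def contract {V : Type u} [AddCommGroup V] [Module K V] (φ : C →ₗ[K] K) : V ⊗[K] C →ₗ[K] V :=
  (TensorProduct.rid K V).toLinearMap ∘ₗ φ.lTensor V

theorem contract_rTensor {V W : Type u} [AddCommGroup V] [Module K V] [AddCommGroup W]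
    [Module K W] (φ : C →ₗ[K] K) (g : V →ₗ[K] W) (t : V ⊗[K] C) :
    contract φ (g.rTensor C t) = g (contract φ t) :=
  (ComodAux.rid_lTensor_natural g φ t).symm

theorem eq_zero_of_contract_eq_zero {V : Type u} [AddCommGroup V] [Module K V] {t : V ⊗[K] C}
    (h : ∀ φ : C →ₗ[K] K, contract φ t = 0) : t = 0 := by
  classical
  let b := Module.Basis.ofVectorSpace K C
  apply (TensorProduct.equivFinsuppOfBasisRight (M := V) b).injective
  ext i
  rw [TensorProduct.equivFinsuppOfBasisRight_apply, map_zero]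
  exact h (b.coord i)

variable [Coalgebra K C]

section Preadditive

variable {M N : RightComod K C}

instance : Zero (M ⟶ N) := ⟨{ toLin := 0, comm := fun m => by simp }⟩

instance : Add (M ⟶ N) :=
  ⟨fun f g =>
    { toLin := f.toLin + g.toLin
      comm := fun m => by
        rw [LinearMap.add_apply, map_add, f.comm, g.comm, LinearMap.rTensor_add,
          LinearMap.add_apply] }⟩

instance : Neg (M ⟶ N) :=
  ⟨fun f =>
    { toLin := -f.toLin
      comm := fun m => by
        rw [LinearMap.neg_apply, map_neg, f.comm, LinearMap.rTensor_neg, LinearMap.neg_apply] }⟩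

instance : AddCommGroup (M ⟶ N) where
  add_assoc _ _ _ := hom_ext (add_assoc _ _ _)
  zero_add _ := hom_ext (zero_add _)
  add_zero _ := hom_ext (add_zero _)
  neg_add_cancel _ := hom_ext (neg_add_cancel _)
  add_comm _ _ := hom_ext (add_comm _ _)
  nsmul := nsmulRec
  zsmul := zsmulRec

instance : Preadditive (RightComod K C) where
  add_comp _ _ _ _ _ _ := hom_ext (LinearMap.comp_add _ _ _)
  comp_add _ _ _ _ _ _ := hom_ext (LinearMap.add_comp _ _ _)

end Preadditive

theorem toLin_congr {M N : RightComod K C} {f g : M ⟶ N} (h : f = g) (m : M.carrier) :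
    f.toLin m = g.toLin m := by rw [h]

theorem isIso_of_bijective {M N : RightComod K C} (f : M ⟶ N)
    (hf : Function.Bijective f.toLin) : IsIso f := by
  let e := LinearEquiv.ofBijective f.toLin hf
  have he : e.symm.toLinearMap ∘ₗ f.toLin = LinearMap.id := e.symm_comp
  refine ⟨{ toLin := e.symm.toLinearMap, comm := fun n => ?_ }, hom_ext he, hom_ext e.comp_symm⟩
  obtain ⟨m, rfl⟩ := hf.2 n
  rw [f.comm, ← LinearMap.rTensor_comp_apply, he, LinearMap.rTensor_id, LinearMap.id_apply]
  exact congrArg M.coact (LinearMap.congr_fun he m)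

section Sub

variable {M N : RightComod K C} {p : Submodule K M.carrier}

/-- A subspace `p` of a comodule is stable if the coaction maps it into `p ⊗ C`, that is, if it is
a subcomodule. -/
def IsStable (M : RightComod K C) (p : Submodule K M.carrier) : Prop :=
  ∀ m ∈ p, M.coact m ∈ LinearMap.range (p.subtype.rTensor C)

/-- The restriction of the coaction to a stable subspace. -/
def subCoact (h : IsStable M p) : p →ₗ[K] p ⊗[K] C :=
  (LinearEquiv.ofInjective _ (rTensor_subtype_injective C p)).symm.toLinearMap ∘ₗ
    (M.coact ∘ₗ p.subtype).codRestrict _ fun m => h m m.2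

theorem subtype_subCoact (h : IsStable M p) (m : p) :
    p.subtype.rTensor C (subCoact h m) = M.coact m :=
  congrArg Subtype.val (LinearEquiv.apply_symm_apply
    (LinearEquiv.ofInjective _ (rTensor_subtype_injective C p)) ⟨M.coact m, h m m.2⟩)

/-- The subcomodule with underlying space a stable subspace. -/
abbrev sub (h : IsStable M p) : RightComod K C where
  carrier := p
  addCommGroup := inferInstance
  module := inferInstance
  coact := subCoact h
  coassoc m := by
    apply rTensor_subtype_injective
    have e : p.subtype.rTensor C ∘ₗ subCoact h = M.coact ∘ₗ p.subtype :=
      LinearMap.ext (subtype_subCoact h)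
    rw [← ComodAux.assoc_rTensor_rTensor, ← LinearMap.rTensor_comp_apply, e,
      LinearMap.rTensor_comp_apply, subtype_subCoact, M.coassoc, ← ComodAux.lTensor_rTensor,
      subtype_subCoact]
  lTensor_counit_coact m := by
    apply rTensor_subtype_injective
    rw [← ComodAux.lTensor_rTensor, subtype_subCoact, M.lTensor_counit_coact]
    rfl

/-- The inclusion of a subcomodule. -/
def subι (h : IsStable M p) : sub h ⟶ M where
  toLin := p.subtype
  comm m := (subtype_subCoact h m).symm

/-- The corestriction of a morphism to a subcomodule containing its image. -/
def subLift (h : IsStable M p) (f : N ⟶ M) (hf : ∀ n, f.toLin n ∈ p) : N ⟶ sub h where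
  toLin := f.toLin.codRestrict p hf
  comm n := by
    apply rTensor_subtype_injective
    rw [← LinearMap.rTensor_comp_apply, LinearMap.subtype_comp_codRestrict, ← f.comm]
    exact subtype_subCoact h _

theorem isStable_ker (f : M ⟶ N) : IsStable M (LinearMap.ker f.toLin) := fun m hm =>
  (Module.Flat.rTensor_exact C (LinearMap.exact_subtype_ker_map f.toLin) _).1 <| by
    rw [← f.comm, LinearMap.mem_ker.1 hm, map_zero]

abbrev kernelFork (f : M ⟶ N) : KernelFork f :=
  KernelFork.ofι (subι (isStable_ker f)) (hom_ext (LinearMap.ext fun m => m.2))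

def isLimitKernelFork (f : M ⟶ N) : IsLimit (kernelFork f) :=
  KernelFork.IsLimit.ofι _ _
    (fun g hg => subLift (isStable_ker f) g (toLin_congr hg))
    (fun _ _ => rfl)
    (fun _ _ _ hb => hom_ext (LinearMap.ext fun n => Subtype.ext (toLin_congr hb n)))

end Sub

variable (K C) in
/-- The forgetful functor from comodules to vector spaces. -/
def forgetMod : RightComod K C ⥤ ModuleCat.{u} K where
  obj M := ModuleCat.of K M.carrier
  map f := ModuleCat.ofHom f.toLin

instance : (forgetMod K C).ReflectsIsomorphisms where
  reflects f _ := isIso_of_bijective f (ConcreteCategory.bijective_of_isIso ((forgetMod K C).map f))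

instance : (forgetMod K C).Additive where

instance : HasKernels (RightComod K C) where
  has_limit f := ⟨⟨_, isLimitKernelFork f⟩⟩

instance {M N : RightComod K C} (f : M ⟶ N) :
    PreservesLimit (parallelPair f 0) (forgetMod K C) :=
  preservesLimit_of_preserves_limit_cone (isLimitKernelFork f) <|
    ((kernelFork f).isLimitMapConeEquiv _).2 <|
      (ModuleCat.kernelIsLimit ((forgetMod K C).map f)).ofIsoLimit (Fork.ext (Iso.refl _))

section Colimits

variable {J : Type*} [Category* J] {G : J ⥤ RightComod K C}

/-- The linear map from a term of a diagram of comodules to a cocone over the underlying vector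
spaces. -/
def coconeι (c : Cocone (G ⋙ forgetMod K C)) (j : J) : (G.obj j).carrier →ₗ[K] c.pt :=
  (c.ι.app j).hom

theorem coconeι_comp (c : Cocone (G ⋙ forgetMod K C)) {i j : J} (a : i ⟶ j) :
    coconeι c j ∘ₗ (G.map a).toLin = coconeι c i :=
  congrArg ModuleCat.Hom.hom (c.w a)

theorem linearMap_ext_of_isColimit {c : Cocone (G ⋙ forgetMod K C)} (hc : IsColimit c)
    {V : Type u} [AddCommGroup V] [Module K V] {f g : c.pt →ₗ[K] V}
    (h : ∀ j m, f (coconeι c j m) = g (coconeι c j m)) : f = g :=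
  congrArg ModuleCat.Hom.hom <| hc.hom_ext (f := ModuleCat.ofHom f) (f' := ModuleCat.ofHom g)
    fun j => ModuleCat.hom_ext (LinearMap.ext (h j))

variable {c : Cocone (G ⋙ forgetMod K C)} (hc : IsColimit c)

/-- The coaction on a colimit of the underlying vector spaces of a diagram of comodules. -/
def colimitCoact : c.pt →ₗ[K] c.pt ⊗[K] C :=
  (hc.desc
    { pt := ModuleCat.of K (c.pt ⊗[K] C)
      ι :=
        { app j := ModuleCat.ofHom ((coconeι c j).rTensor C ∘ₗ (G.obj j).coact)
          naturality i j a := ModuleCat.hom_ext <| LinearMap.ext fun (m : (G.obj i).carrier) => by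
            change (coconeι c j).rTensor C ((G.obj j).coact ((G.map a).toLin m)) =
              (coconeι c i).rTensor C ((G.obj i).coact m)
            rw [(G.map a).comm, ← LinearMap.rTensor_comp_apply, coconeι_comp] } }).hom

theorem colimitCoact_comp_coconeι (j : J) :
    colimitCoact hc ∘ₗ coconeι c j = (coconeι c j).rTensor C ∘ₗ (G.obj j).coact :=
  congrArg ModuleCat.Hom.hom (hc.fac _ j)

theorem colimitCoact_coconeι (j : J) (m : (G.obj j).carrier) :
    colimitCoact hc (coconeι c j m) = (coconeι c j).rTensor C ((G.obj j).coact m) :=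
  LinearMap.congr_fun (colimitCoact_comp_coconeι hc j) m

/-- The comodule structure on a colimit of the underlying vector spaces of a diagram of
comodules. -/
abbrev colimitObj : RightComod K C where
  carrier := c.pt
  addCommGroup := inferInstance
  module := inferInstance
  coact := colimitCoact hc
  coassoc := by
    refine LinearMap.congr_fun (f := (TensorProduct.assoc K _ C C).toLinearMap ∘ₗ
      (colimitCoact hc).rTensor C ∘ₗ colimitCoact hc)
      (g := (Coalgebra.comul (R := K) (A := C)).lTensor _ ∘ₗ colimitCoact hc)
      (linearMap_ext_of_isColimit hc fun j m => ?_)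
    simp only [LinearMap.comp_apply, LinearEquiv.coe_coe]
    rw [colimitCoact_coconeι, ← LinearMap.rTensor_comp_apply, colimitCoact_comp_coconeι,
      LinearMap.rTensor_comp_apply, ComodAux.assoc_rTensor_rTensor, (G.obj j).coassoc,
      ComodAux.lTensor_rTensor]
  lTensor_counit_coact := by
    refine LinearMap.congr_fun
      (f := (Coalgebra.counit (R := K) (A := C)).lTensor _ ∘ₗ colimitCoact hc)
      (g := (TensorProduct.mk K _ K).flip 1) (linearMap_ext_of_isColimit hc fun j m => ?_)
    rw [LinearMap.comp_apply, colimitCoact_coconeι, ComodAux.lTensor_rTensor,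
      (G.obj j).lTensor_counit_coact]
    rfl

/-- The lift of a colimit cocone of underlying vector spaces to a cocone of comodules. -/
abbrev colimitCocone : Cocone G where
  pt := colimitObj hc
  ι :=
    { app j := { toLin := coconeι c j, comm := colimitCoact_coconeι hc j }
      naturality _ _ a := hom_ext (congrArg ModuleCat.Hom.hom (c.ι.naturality a)) }

def isColimitColimitCocone : IsColimit (colimitCocone hc) where
  desc s :=
    { toLin := (hc.desc ((forgetMod K C).mapCocone s)).hom
      comm := by
        set d : c.pt →ₗ[K] s.pt.carrier := (hc.desc ((forgetMod K C).mapCocone s)).hom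
        have hd (j : J) : d ∘ₗ coconeι c j = (s.ι.app j).toLin :=
          congrArg ModuleCat.Hom.hom (hc.fac ((forgetMod K C).mapCocone s) j)
        refine LinearMap.congr_fun (f := s.pt.coact ∘ₗ d) (g := d.rTensor C ∘ₗ colimitCoact hc)
          (linearMap_ext_of_isColimit hc fun j m => ?_)
        rw [LinearMap.comp_apply, LinearMap.comp_apply, colimitCoact_coconeι,
          ← LinearMap.rTensor_comp_apply, hd, ← (s.ι.app j).comm, ← hd]
        rfl }
  fac s j := hom_ext (congrArg ModuleCat.Hom.hom (hc.fac ((forgetMod K C).mapCocone s) j))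
  uniq s f hf := hom_ext <| congrArg ModuleCat.Hom.hom <|
    hc.uniq ((forgetMod K C).mapCocone s) ((forgetMod K C).map f) fun j =>
      congrArg (forgetMod K C).map (hf j)

instance : CreatesColimitsOfSize (forgetMod K C) where
  CreatesColimitsOfShape :=
    { CreatesColimit := createsColimitOfReflectsIso fun c hc =>
        { liftedCocone := colimitCocone hc
          validLift := Cocone.ext (Iso.refl _)
          makesColimit := isColimitColimitCocone hc } }

instance : HasColimits (RightComod K C) :=
  hasColimits_of_hasColimits_createsColimits (forgetMod K C)

end Colimits

instance : Abelian (RightComod K C) :=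
  have : HasFiniteBiproducts (RightComod K C) := HasFiniteBiproducts.of_hasFiniteCoproducts
  have := hasFiniteProducts_of_hasFiniteBiproducts
  abelianOfReflectsIsomorphisms (forgetMod K C)

theorem mono_iff_injective {M N : RightComod K C} (f : M ⟶ N) :
    Mono f ↔ Function.Injective f.toLin := by
  have : PreservesFiniteLimits (forgetMod K C) :=
    (forgetMod K C).preservesFiniteLimits_of_preservesKernels
  rw [← (forgetMod K C).mono_map_iff_mono, ModuleCat.mono_iff_injective]
  rfl

variable {D : Type u} [AddCommGroup D] [Module K D] [Coalgebra K D]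

/-- `M^(Λ)` is isomorphic to `V ⊗ M` for a vector space `V` with a basis indexed by `Λ`. -/
def directSumIsoTensor (M : RightComod K C) {V Λ : Type u} [AddCommGroup V] [Module K V]
    (b : Module.Basis Λ K V) : directSum M Λ ≅ tensorObj M V := by
  classical
  let e : (Λ →₀ M.carrier) ≃ₗ[K] V ⊗[K] M.carrier :=
    (TensorProduct.equivFinsuppOfBasisLeft b).symm
  have he (i : Λ) : e.toLinearMap ∘ₗ Finsupp.lsingle i = TensorProduct.mk K V M.carrier (b i) :=
    LinearMap.ext fun m => TensorProduct.equivFinsuppOfBasisLeft_symm_apply b _ |>.trans (by simp)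
  have assoc_symm_tmul (v : V) (t : M.carrier ⊗[K] C) :
      (TensorProduct.assoc K V M.carrier C).symm (v ⊗ₜ[K] t) =
        (TensorProduct.mk K V M.carrier v).rTensor C t := by
    induction t using TensorProduct.induction_on with
    | zero => simp only [TensorProduct.tmul_zero, map_zero]
    | add s t hs ht => simp only [TensorProduct.tmul_add, map_add, hs, ht]
    | tmul m c => rfl
  let f : directSum M Λ ⟶ tensorObj M V :=
    { toLin := e.toLinearMap
      comm := LinearMap.congr_fun (f := (tensorObj M V).coact ∘ₗ e.toLinearMap)
        (g := e.toLinearMap.rTensor C ∘ₗ (directSum M Λ).coact) <| Finsupp.lhom_ext fun i m => by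
          have hem : e (Finsupp.single i m) = b i ⊗ₜ[K] m := LinearMap.congr_fun (he i) m
          calc (tensorObj M V).coact (e (Finsupp.single i m))
            _ = (TensorProduct.assoc K V M.carrier C).symm (b i ⊗ₜ[K] M.coact m) := by
              rw [hem]; rfl
            _ = (e.toLinearMap ∘ₗ Finsupp.lsingle i).rTensor C (M.coact m) := by
              rw [assoc_symm_tmul, he]
            _ = e.toLinearMap.rTensor C (ComodAux.sumCoact Λ M.coact (Finsupp.single i m)) := by
              rw [ComodAux.sumCoact_single, LinearMap.rTensor_comp_apply] }
  have : IsIso f := isIso_of_bijective f e.bijective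
  exact asIso f

section Exactness

variable {α : C →ₗc[K] D} [IsQuasiFinite (overCod α)]

theorem shriekDesc_coev {N : RightComod K D} {W : RightComod K C}
    (f : N ⟶ (corestrict α).obj W) (n : N.carrier) :
    (shriekDesc α N W f).toLin.rTensor C (coev α N n) = W.coact (f.toLin n) :=
  lift_coev (f ≫ coactHom α W) n

theorem shriek_map_coev {N N' : RightComod K D} (f : N ⟶ N') (n : N.carrier) :
    ((shriek α).map f).toLin.rTensor C (coev α N n) = coev α N' (f.toLin n) :=
  (shriekDesc_coev (f ≫ shriekHomEquiv α N' _ (𝟙 _)) n).trans (shriekCoact_unit α N' (f.toLin n))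

theorem shriek_map_toLin {N N' : RightComod K D} (f : N ⟶ N') :
    ((shriek α).map f).toLin = ((cohom (overCod α)).map f).hom :=
  cohom_ext fun n => (shriek_map_coev f n).trans
    (toLin_congr ((cohomAdj (overCod α)).unit.naturality f) n)

theorem IsSigmaInjective.cohom_preservesMonomorphisms (hα : IsSigmaInjective α) :
    (cohom (overCod α)).PreservesMonomorphisms :=
  have : (tensorFunctor (overCod α)).PreservesInjectiveObjects :=
    ⟨fun {V} _ => Injective.of_iso
      (directSumIsoTensor (overCod α) (Module.Basis.ofVectorSpace K V)) (hα _)⟩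
  Functor.preservesMonomorphisms_of_adjunction_of_preservesInjectiveObjects
    (cohomAdj (overCod α))

theorem IsSigmaInjective.shriek_preservesMonomorphisms (hα : IsSigmaInjective α) :
    (shriek α).PreservesMonomorphisms where
  preserves f _ := by
    have := hα.cohom_preservesMonomorphisms
    rw [mono_iff_injective, shriek_map_toLin]
    exact (ModuleCat.mono_iff_injective _).1 ((cohom (overCod α)).map_mono f)

instance (α : C →ₗc[K] D) : (corestrict α).Additive where

instance : (shriek α).IsLeftAdjoint := ⟨_, ⟨shriekAdj α⟩⟩

theorem IsSigmaInjective.shriek_preservesKernels (hα : IsSigmaInjective α) {N N' : RightComod K D}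
    (f : N ⟶ N') : PreservesLimit (parallelPair f 0) (shriek α) :=
  have := hα.shriek_preservesMonomorphisms
  (Functor.preservesHomology_of_preservesMonos_and_cokernels (shriek α)).preservesKernels f

theorem span_contract_coev (N : RightComod K D) :
    Submodule.span K {h | ∃ (φ : C →ₗ[K] K) (n : N.carrier), contract φ (coev α N n) = h} = ⊤ := by
  set S := Submodule.span K {h | ∃ (φ : C →ₗ[K] K) (n : N.carrier), contract φ (coev α N n) = h}
  have h : S.mkQ = 0 := cohom_ext fun n => by
    rw [LinearMap.rTensor_zero, LinearMap.zero_apply]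
    refine eq_zero_of_contract_eq_zero fun φ => ?_
    rw [contract_rTensor, Submodule.mkQ_apply, Submodule.Quotient.mk_eq_zero]
    exact Submodule.subset_span ⟨φ, n, rfl⟩
  rw [← Submodule.ker_mkQ S, h, LinearMap.ker_zero]

theorem exists_finite_mem_range_shriek_map (N : RightComod K D)
    (h : (cohom (overCod α)).obj N) :
    ∃ T : Set N.carrier, T.Finite ∧ ∀ (p : Submodule K N.carrier) (hp : IsStable N p), T ⊆ p →
      h ∈ LinearMap.range ((shriek α).map (subι hp)).toLin := by
  have h_mem : h ∈ Submodule.span K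
      {h | ∃ (φ : C →ₗ[K] K) (n : N.carrier), contract φ (coev α N n) = h} :=
    span_contract_coev (α := α) N ▸ Submodule.mem_top
  induction h_mem using Submodule.span_induction with
  | mem _ hx =>
    obtain ⟨φ, n, rfl⟩ := hx
    refine ⟨{n}, Set.finite_singleton n, fun p hp hT =>
      ⟨contract φ (coev α (sub hp) ⟨n, hT rfl⟩), ?_⟩⟩
    exact (contract_rTensor φ _ _).symm.trans
      (congrArg (contract φ) (shriek_map_coev (subι hp) ⟨n, hT rfl⟩))
  | zero => exact ⟨∅, Set.finite_empty, fun p hp _ => Submodule.zero_mem _⟩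
  | add x y _ _ hx hy =>
    obtain ⟨S, hS, hxS⟩ := hx
    obtain ⟨T, hT, hyT⟩ := hy
    exact ⟨S ∪ T, hS.union hT, fun p hp h => Submodule.add_mem _
      (hxS p hp (Set.subset_union_left.trans h)) (hyT p hp (Set.subset_union_right.trans h))⟩
  | smul a x _ hx =>
    obtain ⟨S, hS, hxS⟩ := hx
    exact ⟨S, hS, fun p hp h => Submodule.smul_mem _ a (hxS p hp h)⟩

end Exactness

end RightComod

namespace TransComod

variable {K : Type u} [Field K] {X : Type u} [Category.{u} X] {𝒞 : X ⥤ CoalgCat.{u} K}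

variable {K : Type u} [Field K] {X : Type u} [Category.{u} X] {𝒞 : X ⥤ CoalgCat.{u} K}

theorem hom_ext {M N : TransComod 𝒞} {f g : M ⟶ N} (h : ∀ x, f.app x = g.app x) : f = g :=
  Hom.ext (funext h)

section Preadditive

variable {M N : TransComod 𝒞}

instance : Zero (M ⟶ N) :=
  ⟨{ app := fun _ => 0
     naturality := fun α => by rw [Functor.map_zero, comp_zero, zero_comp] }⟩

instance : Add (M ⟶ N) :=
  ⟨fun f g =>
    { app := fun x => f.app x + g.app x
      naturality := fun α => by
        rw [Functor.map_add, Preadditive.comp_add, Preadditive.add_comp, f.naturality,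
          g.naturality] }⟩

instance : Neg (M ⟶ N) :=
  ⟨fun f =>
    { app := fun x => -f.app x
      naturality := fun α => by
        rw [Functor.map_neg, Preadditive.comp_neg, Preadditive.neg_comp, f.naturality] }⟩

instance : AddCommGroup (M ⟶ N) where
  add_assoc _ _ _ := hom_ext fun _ => add_assoc _ _ _
  zero_add _ := hom_ext fun _ => zero_add _
  add_zero _ := hom_ext fun _ => add_zero _
  neg_add_cancel _ := hom_ext fun _ => neg_add_cancel _
  add_comm _ _ := hom_ext fun _ => add_comm _ _
  nsmul := nsmulRec
  zsmul := zsmulRec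

instance : Preadditive (TransComod 𝒞) where
  add_comp _ _ _ _ _ _ := hom_ext fun _ => Preadditive.add_comp _ _ _ _ _ _
  comp_add _ _ _ _ _ _ := hom_ext fun _ => Preadditive.comp_add _ _ _ _ _ _

end Preadditive

variable (𝒞) in
/-- Evaluation of trans-comodules at an object of `X`. -/
def ev (x : X) : TransComod 𝒞 ⥤ RightComod K (𝒞.obj x) where
  obj M := M.obj x
  map f := f.app x

instance (x : X) : (ev 𝒞 x).Additive where

theorem isIso_of_isIso_app {M N : TransComod 𝒞} (f : M ⟶ N) [∀ x, IsIso (f.app x)] : IsIso f := by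
  refine ⟨{ app := fun x => inv (f.app x), naturality := fun α => ?_ },
    hom_ext fun x => IsIso.hom_inv_id (f.app x), hom_ext fun x => IsIso.inv_hom_id (f.app x)⟩
  rw [Functor.map_inv, IsIso.comp_inv_eq, Category.assoc, f.naturality, IsIso.inv_hom_id_assoc]

/-- The structure morphism `_αM`, as a linear map `M_y → M_x`. -/
abbrev mapLin (M : TransComod 𝒞) {x y : X} (α : x ⟶ y) :
    (M.obj y).carrier →ₗ[K] (M.obj x).carrier :=
  (M.map α).toLin

theorem mapLin_comm (M : TransComod 𝒞) {x y : X} (α : x ⟶ y) (m : (M.obj y).carrier) :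
    (𝒞.map α).toCoalgHom.toLinearMap.lTensor _ ((M.obj x).coact (M.mapLin α m)) =
      (M.mapLin α).rTensor _ ((M.obj y).coact m) :=
  (M.map α).comm m

theorem app_mapLin {M N : TransComod 𝒞} (f : M ⟶ N) {x y : X} (α : x ⟶ y)
    (m : (M.obj y).carrier) :
    (f.app x).toLin (M.mapLin α m) = N.mapLin α ((f.app y).toLin m) :=
  RightComod.toLin_congr (f.naturality α) m

section Sub

variable {M N : TransComod 𝒞} {p : ∀ x, Submodule K (M.obj x).carrier}

/-- A family of subspaces of a trans-comodule is stable if it consists of subcomodules and is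
preserved by the structure morphisms, that is, if it is a sub-trans-comodule. -/
structure IsStable (M : TransComod 𝒞) (p : ∀ x, Submodule K (M.obj x).carrier) : Prop where
  isStable_obj (x : X) : RightComod.IsStable (M.obj x) (p x)
  mapLin_mem {x y : X} (α : x ⟶ y) (m : (M.obj y).carrier) (hm : m ∈ p y) : M.mapLin α m ∈ p x

/-- The sub-trans-comodule with underlying spaces a stable family of subspaces. -/
abbrev sub (h : IsStable M p) : TransComod 𝒞 where
  obj x := RightComod.sub (h.isStable_obj x)
  map {x y} α :=
    { toLin := (M.mapLin α).restrict (h.mapLin_mem α)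
      comm := fun m => by
        have e : (p x).subtype ∘ₗ (M.mapLin α).restrict (h.mapLin_mem α) =
          M.mapLin α ∘ₗ (p y).subtype := rfl
        apply RightComod.rTensor_subtype_injective
        rw [← LinearMap.rTensor_comp_apply, e, LinearMap.rTensor_comp_apply,
          RightComod.subtype_subCoact, ← mapLin_comm, LinearMap.comp_apply,
          ← ComodAux.lTensor_rTensor, RightComod.subtype_subCoact]
        rfl }
  map_id x m := Subtype.ext (M.map_id x m)
  map_comp α β m := Subtype.ext (M.map_comp α β m)

/-- The inclusion of a sub-trans-comodule. -/
def subι (h : IsStable M p) : sub h ⟶ M where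
  app x := RightComod.subι (h.isStable_obj x)
  naturality _ := rfl

/-- The corestriction of a morphism to a sub-trans-comodule containing its image. -/
def subLift (h : IsStable M p) (f : N ⟶ M) (hf : ∀ x n, (f.app x).toLin n ∈ p x) : N ⟶ sub h where
  app x := RightComod.subLift (h.isStable_obj x) (f.app x) (hf x)
  naturality α := RightComod.hom_ext (LinearMap.ext fun n => Subtype.ext (app_mapLin f α n))

theorem isStable_ker (f : M ⟶ N) : IsStable M fun x => LinearMap.ker (f.app x).toLin where
  isStable_obj x := RightComod.isStable_ker (f.app x)
  mapLin_mem α m hm := LinearMap.mem_ker.2 <| (app_mapLin f α m).trans <|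
    (congrArg (N.mapLin α) (LinearMap.mem_ker.1 hm)).trans (map_zero _)

abbrev kernelFork (f : M ⟶ N) : KernelFork f :=
  KernelFork.ofι (subι (isStable_ker f))
    (hom_ext fun _ => RightComod.hom_ext (LinearMap.ext fun m => m.2))

theorem toLin_app_congr {f g : M ⟶ N} (h : f = g) (x : X) (m : (M.obj x).carrier) :
    (f.app x).toLin m = (g.app x).toLin m := by rw [h]

def isLimitKernelFork (f : M ⟶ N) : IsLimit (kernelFork f) :=
  KernelFork.IsLimit.ofι _ _
    (fun g hg => subLift (isStable_ker f) g (toLin_app_congr hg))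
    (fun _ _ => rfl)
    (fun _ _ _ hb => hom_ext fun x => RightComod.hom_ext (LinearMap.ext fun n =>
      Subtype.ext (toLin_app_congr hb x n)))

end Sub

instance : HasKernels (TransComod 𝒞) where
  has_limit f := ⟨⟨_, isLimitKernelFork f⟩⟩

instance {M N : TransComod 𝒞} (f : M ⟶ N) (x : X) :
    PreservesLimit (parallelPair f 0) (ev 𝒞 x) :=
  preservesLimit_of_preserves_limit_cone (isLimitKernelFork f) <|
    ((kernelFork f).isLimitMapConeEquiv _).2 <|
      (RightComod.isLimitKernelFork (f.app x)).ofIsoLimit (Fork.ext (Iso.refl _))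

section Colimits

variable {J : Type u} [SmallCategory J] (F : J ⥤ TransComod 𝒞)

/-- The structure morphism of the pointwise colimit of a diagram of trans-comodules. -/
def colimitMap {x y : X} (α : x ⟶ y) : colimit (F ⋙ ev 𝒞 y) ⟶
    (RightComod.corestrict (𝒞.map α).toCoalgHom).obj (colimit (F ⋙ ev 𝒞 x)) :=
  colimit.desc (F ⋙ ev 𝒞 y)
    { pt := (RightComod.corestrict (𝒞.map α).toCoalgHom).obj (colimit (F ⋙ ev 𝒞 x))
      ι :=
        { app j := (F.obj j).map α ≫
            (RightComod.corestrict (𝒞.map α).toCoalgHom).map (colimit.ι (F ⋙ ev 𝒞 x) j)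
          naturality i j a := RightComod.hom_ext <| LinearMap.ext fun m => calc
            (colimit.ι (F ⋙ ev 𝒞 x) j).toLin ((F.obj j).mapLin α (((F.map a).app y).toLin m))
            _ = (colimit.ι (F ⋙ ev 𝒞 x) j).toLin (((F.map a).app x).toLin ((F.obj i).mapLin α m)) :=
              congrArg _ (app_mapLin (F.map a) α m).symm
            _ = (colimit.ι (F ⋙ ev 𝒞 x) i).toLin ((F.obj i).mapLin α m) :=
              RightComod.toLin_congr (colimit.w (F ⋙ ev 𝒞 x) a) _ } }

theorem ι_colimitMap {x y : X} (α : x ⟶ y) (j : J) :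
    colimit.ι (F ⋙ ev 𝒞 y) j ≫ colimitMap F α = (F.obj j).map α ≫
      (RightComod.corestrict (𝒞.map α).toCoalgHom).map (colimit.ι (F ⋙ ev 𝒞 x) j) :=
  colimit.ι_desc _ j

theorem colimitMap_ι_apply {x y : X} (α : x ⟶ y) (j : J) (m : ((F.obj j).obj y).carrier) :
    (colimitMap F α).toLin ((colimit.ι (F ⋙ ev 𝒞 y) j).toLin m) =
      (colimit.ι (F ⋙ ev 𝒞 x) j).toLin ((F.obj j).mapLin α m) :=
  RightComod.toLin_congr (ι_colimitMap F α j) m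

theorem linearMap_ext_of_colimit {x : X} {V : Type u} [AddCommGroup V] [Module K V]
    {f g : (colimit (F ⋙ ev 𝒞 x)).carrier →ₗ[K] V}
    (h : ∀ j m, f ((colimit.ι (F ⋙ ev 𝒞 x) j).toLin m) =
      g ((colimit.ι (F ⋙ ev 𝒞 x) j).toLin m)) : f = g :=
  RightComod.linearMap_ext_of_isColimit
    (isColimitOfPreserves (RightComod.forgetMod K (𝒞.obj x)) (colimit.isColimit _)) h

/-- The pointwise colimit of a diagram of trans-comodules. -/
abbrev colimitObj : TransComod 𝒞 where
  obj x := colimit (F ⋙ ev 𝒞 x)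
  map α := colimitMap F α
  map_id x := LinearMap.congr_fun (f := (colimitMap F (𝟙 x)).toLin) (g := LinearMap.id) <|
    linearMap_ext_of_colimit F fun j m => (colimitMap_ι_apply F (𝟙 x) j m).trans <|
      congrArg (colimit.ι (F ⋙ ev 𝒞 x) j).toLin ((F.obj j).map_id x m)
  map_comp {x y _} α β := LinearMap.congr_fun (f := (colimitMap F (α ≫ β)).toLin)
      (g := (colimitMap F α).toLin ∘ₗ (colimitMap F β).toLin) <|
    linearMap_ext_of_colimit F fun j m => calc
      _ = (colimit.ι (F ⋙ ev 𝒞 x) j).toLin ((F.obj j).mapLin (α ≫ β) m) :=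
        colimitMap_ι_apply F (α ≫ β) j m
      _ = (colimit.ι (F ⋙ ev 𝒞 x) j).toLin ((F.obj j).mapLin α ((F.obj j).mapLin β m)) :=
        congrArg _ ((F.obj j).map_comp α β m)
      _ = (colimitMap F α).toLin ((colimit.ι (F ⋙ ev 𝒞 y) j).toLin ((F.obj j).mapLin β m)) :=
        (colimitMap_ι_apply F α j _).symm
      _ = _ := congrArg (colimitMap F α).toLin (colimitMap_ι_apply F β j m).symm

abbrev colimitCocone : Cocone F where
  pt := colimitObj F
  ι :=
    { app j :=
        { app x := colimit.ι (F ⋙ ev 𝒞 x) j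
          naturality α := (ι_colimitMap F α j).symm }
      naturality _ _ a := hom_ext fun x => (colimit.cocone (F ⋙ ev 𝒞 x)).ι.naturality a }

def isColimitColimitCocone : IsColimit (colimitCocone F) where
  desc s :=
    { app x := colimit.desc (F ⋙ ev 𝒞 x) ((ev 𝒞 x).mapCocone s)
      naturality {x y} α := RightComod.hom_ext <| linearMap_ext_of_colimit F fun j m => by
        let d (x : X) : (colimit (F ⋙ ev 𝒞 x)).carrier →ₗ[K] (s.pt.obj x).carrier :=
          (colimit.desc (F ⋙ ev 𝒞 x) ((ev 𝒞 x).mapCocone s)).toLin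
        have hd (x : X) (m : ((F.obj j).obj x).carrier) :
            d x ((colimit.ι (F ⋙ ev 𝒞 x) j).toLin m) = ((s.ι.app j).app x).toLin m :=
          RightComod.toLin_congr (colimit.ι_desc ((ev 𝒞 x).mapCocone s) j) m
        calc d x ((colimitMap F α).toLin ((colimit.ι (F ⋙ ev 𝒞 y) j).toLin m))
          _ = d x ((colimit.ι (F ⋙ ev 𝒞 x) j).toLin ((F.obj j).mapLin α m)) :=
            congrArg (d x) (colimitMap_ι_apply F α j m)
          _ = s.pt.mapLin α (((s.ι.app j).app y).toLin m) :=
            (hd x _).trans (app_mapLin (s.ι.app j) α m)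
          _ = s.pt.mapLin α (d y ((colimit.ι (F ⋙ ev 𝒞 y) j).toLin m)) :=
            congrArg (s.pt.mapLin α) (hd y m).symm }
  fac s j := hom_ext fun x => colimit.ι_desc ((ev 𝒞 x).mapCocone s) j
  uniq s f hf := hom_ext fun x => colimit.hom_ext fun j =>
    (congrArg (Hom.app · x) (hf j)).trans (colimit.ι_desc ((ev 𝒞 x).mapCocone s) j).symm

instance : HasColimits (TransComod 𝒞) where
  has_colimits_of_shape _ _ := ⟨fun F => ⟨⟨_, isColimitColimitCocone F⟩⟩⟩

instance (x : X) : PreservesColimits (ev 𝒞 x) where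
  preservesColimitsOfShape := ⟨fun {F} =>
    preservesColimit_of_preserves_colimit_cocone (isColimitColimitCocone F)
      ((colimit.isColimit (F ⋙ ev 𝒞 x)).ofIsoColimit (Cocone.ext (Iso.refl _)))⟩

end Colimits

variable (𝒞) in
/-- The family of the underlying vector spaces of a trans-comodule. -/
def toFamily : TransComod 𝒞 ⥤ Discrete X ⥤ ModuleCat.{u} K where
  obj M := Discrete.functor fun x => (RightComod.forgetMod K _).obj (M.obj x)
  map f := Discrete.natTrans fun x => (RightComod.forgetMod K _).map (f.app x.as)

instance : (toFamily 𝒞).ReflectsIsomorphisms where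
  reflects f _ :=
    have (x : X) : IsIso (f.app x) := RightComod.isIso_of_bijective (f.app x) <|
      ConcreteCategory.bijective_of_isIso (((toFamily 𝒞).map f).app ⟨x⟩)
    isIso_of_isIso_app f

instance : (toFamily 𝒞).Additive where

instance {M N : TransComod 𝒞} (f : M ⟶ N) : PreservesLimit (parallelPair f 0) (toFamily 𝒞) where
  preserves hc := ⟨evaluationJointlyReflectsLimits _ fun x =>
    have := preservesKernel_comp (ev 𝒞 x.as) (RightComod.forgetMod K _) f
    isLimitOfPreserves (ev 𝒞 x.as ⋙ RightComod.forgetMod K _) hc⟩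

instance : PreservesColimits (toFamily 𝒞) where
  preservesColimitsOfShape := ⟨fun {_} => ⟨fun hc => ⟨evaluationJointlyReflectsColimits _ fun x =>
    isColimitOfPreserves (ev 𝒞 x.as ⋙ RightComod.forgetMod K _) hc⟩⟩⟩

instance : HasFiniteBiproducts (TransComod 𝒞) := HasFiniteBiproducts.of_hasFiniteCoproducts

instance : Abelian (TransComod 𝒞) :=
  have := hasFiniteProducts_of_hasFiniteBiproducts (C := TransComod 𝒞)
  abelianOfReflectsIsomorphisms (toFamily 𝒞)

instance : AB5OfSize.{u, u} (TransComod 𝒞) :=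
  have : AB5OfSize.{u, u} (Discrete X ⥤ ModuleCat.{u} K) := ⟨fun _ _ _ => inferInstance⟩
  ab5OfSize_of_reflectsIsomorphisms (toFamily 𝒞)

section Relations

variable {V : X → Type u} [∀ x, AddCommGroup (V x)] [∀ x, Module K (V x)]

variable (𝒞 V) in
/-- A description of a quotient of the family `V` with a trans-comodule structure: the graphs of
the coactions and of the structure morphisms, pulled back to `V`. The kernels of the quotient maps
need not be recorded, since they can be read off from the graphs of the identities `_{id}M`. -/
structure Relations : Type u where
  coact (x : X) : Set (V x × V x ⊗[K] 𝒞.obj x)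
  map {x y : X} (α : x ⟶ y) : Set (V y × V x)

/-- The relations satisfied in a trans-comodule by the images of the elements of `V`. -/
def relations (M : TransComod 𝒞) (q : ∀ x, V x →ₗ[K] (M.obj x).carrier) : Relations 𝒞 V where
  coact x := {r | (M.obj x).coact (q x r.1) = (q x).rTensor _ r.2}
  map {x y} α := {r | M.mapLin α (q y r.1) = q x r.2}

variable {M N : TransComod 𝒞} {q : ∀ x, V x →ₗ[K] (M.obj x).carrier}
  {q' : ∀ x, V x →ₗ[K] (N.obj x).carrier}

theorem coact_eq_iff_of_relations_eq (h : relations M q = relations N q') {x : X} {a : V x}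
    {t : V x ⊗[K] 𝒞.obj x} :
    (M.obj x).coact (q x a) = (q x).rTensor _ t ↔ (N.obj x).coact (q' x a) = (q' x).rTensor _ t :=
  Set.ext_iff.1 (congrArg (fun r => r.coact x) h) (a, t)

theorem mapLin_eq_iff_of_relations_eq (h : relations M q = relations N q') {x y : X} {α : x ⟶ y}
    {a : V y} {b : V x} : M.mapLin α (q y a) = q x b ↔ N.mapLin α (q' y a) = q' x b :=
  Set.ext_iff.1 (congrArg (fun r => r.map α) h) (a, b)

theorem ker_le_ker_of_relations_eq (h : relations M q = relations N q') (x : X) :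
    LinearMap.ker (q x) ≤ LinearMap.ker (q' x) := fun a ha => by
  have hM : M.mapLin (𝟙 x) (q x a) = q x 0 := by
    rw [map_zero]
    exact (M.map_id x _).trans ha
  rw [LinearMap.mem_ker, ← map_zero (q' x), ← (mapLin_eq_iff_of_relations_eq h).1 hM]
  exact (N.map_id x _).symm

theorem exists_hom_of_relations_eq (hq : ∀ x, Function.Surjective (q x))
    (h : relations M q = relations N q') :
    ∃ f : M ⟶ N, ∀ x a, (f.app x).toLin (q x a) = q' x a := by
  let φ (x : X) : (M.obj x).carrier →ₗ[K] (N.obj x).carrier :=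
    (LinearMap.ker (q x)).liftQ (q' x) (ker_le_ker_of_relations_eq h x) ∘ₗ
      ((q x).quotKerEquivOfSurjective (hq x)).symm.toLinearMap
  have hφ (x : X) (a : V x) : φ x (q x a) = q' x a :=
    congrArg ((LinearMap.ker (q x)).liftQ (q' x) (ker_le_ker_of_relations_eq h x))
      ((q x).quotKerEquivOfSurjective_symm_apply (hq x) a)
  refine ⟨{ app := fun x => { toLin := φ x, comm := fun m => ?_ }, naturality := ?_ }, hφ⟩
  · obtain ⟨a, rfl⟩ := hq x m
    obtain ⟨t, ht⟩ := LinearMap.rTensor_surjective (𝒞.obj x) (hq x) ((M.obj x).coact (q x a))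
    rw [hφ, (coact_eq_iff_of_relations_eq h).1 ht.symm, ← ht, ← LinearMap.rTensor_comp_apply,
      LinearMap.ext (f := φ x ∘ₗ q x) (hφ x)]
  · refine fun {x y} α => RightComod.hom_ext (LinearMap.ext fun m => ?_)
    obtain ⟨a, rfl⟩ := hq y m
    obtain ⟨b, hb⟩ := hq x (M.mapLin α (q y a))
    calc φ x (M.mapLin α (q y a))
      _ = q' x b := by rw [← hb, hφ]
      _ = N.mapLin α (φ y (q y a)) := by
        rw [hφ, (mapLin_eq_iff_of_relations_eq h).1 hb.symm]

end Relations

variable (X) in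
/-- Names for the generators, at each object, of a cartesian sub-trans-comodule containing a given
family of elements. Starting from `base`, the constructors `coact`, `map` and `lift` adjoin what is
needed for the spaces spanned by the generators to be stable under the coactions, stable under the
structure morphisms `_αM`, and contained in the images of the morphisms `^αM`. -/
inductive GenWord : X → Type u
  | base (x : X) : GenWord x
  | coact {x : X} (w : GenWord x) (n : ℕ) : GenWord x
  | map {x y : X} (α : x ⟶ y) (w : GenWord y) : GenWord x
  | lift {x y : X} (α : x ⟶ y) (w : GenWord x) (n : ℕ) : GenWord y

/-- The element named by a generating word, where `g` is the given family, `c m` is a sequence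
involved in the coaction of `m`, and `d α m` is a sequence involved in a preimage of `m` under
`^αM`. -/
def GenWord.eval {M : TransComod 𝒞} (g : ∀ x, (M.obj x).carrier)
    (c : ∀ x, (M.obj x).carrier → ℕ → (M.obj x).carrier)
    (d : ∀ {x y : X}, (x ⟶ y) → (M.obj x).carrier → ℕ → (M.obj y).carrier) :
    ∀ {x : X}, GenWord X x → (M.obj x).carrier
  | _, base x => g x
  | _, coact w n => c _ (w.eval g c d) n
  | _, map α w => M.mapLin α (w.eval g c d)
  | _, lift α w n => d α (w.eval g c d) n

theorem exists_seq_coact_mem (M : TransComod 𝒞) (x : X) (m : (M.obj x).carrier) :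
    ∃ c : ℕ → (M.obj x).carrier, ∀ p : Submodule K (M.obj x).carrier, (∀ n, c n ∈ p) →
      (M.obj x).coact m ∈ LinearMap.range (p.subtype.rTensor (𝒞.obj x)) := by
  obtain ⟨T, hT, h⟩ := RightComod.exists_finite_mem_range_rTensor ((M.obj x).coact m)
  obtain ⟨c, hc⟩ := (hT.insert 0).countable.exists_eq_range ⟨_, Set.mem_insert _ _⟩
  exact ⟨c, fun p hp => h p ((Set.subset_insert 0 T).trans (hc ▸ Set.range_subset_iff.2 hp))⟩

variable [IsQuasiFiniteRep 𝒞]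

theorem shriekMap_naturality {M N : TransComod 𝒞} (f : M ⟶ N) {x y : X} (α : x ⟶ y) :
    (RightComod.shriek (𝒞.map α).toCoalgHom).map (f.app y) ≫ N.shriekMap α =
      M.shriekMap α ≫ f.app x := by
  rw [shriekMap, shriekMap, ← Adjunction.homEquiv_naturality_left_symm,
    ← Adjunction.homEquiv_naturality_right_symm, f.naturality]

/-- The morphisms `^αM : α^! M_y ⟶ M_x`, as a natural transformation in `M`. -/
def shriekMapNatTrans {x y : X} (α : x ⟶ y) :
    ev 𝒞 y ⋙ RightComod.shriek (𝒞.map α).toCoalgHom ⟶ ev 𝒞 x where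
  app M := M.shriekMap α
  naturality _ _ f := shriekMap_naturality f α

instance (J : Type u) [SmallCategory J] : (IsCartesian 𝒞).IsClosedUnderColimitsOfShape J where
  colimitsOfShape_le := by
    rintro M ⟨h⟩ x y α
    have : IsIso (Functor.whiskerLeft h.diag (shriekMapNatTrans α)) :=
      (NatTrans.isIso_iff_isIso_app _).2 fun j => h.prop_diag_obj j α
    exact isIso_app_coconePt_of_preservesColimit h.diag (shriekMapNatTrans α) h.cocone h.isColimit

theorem isClosedUnderKernels_isCartesian (hinj : IsSigmaInjectiveRep 𝒞) :
    (IsCartesian 𝒞).IsClosedUnderKernels where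
  kernels_le := by
    rintro _ ⟨f, k, hk, hM, hN⟩ x y α
    have := (hinj α).shriek_preservesKernels ((ev 𝒞 y).map f)
    have : PreservesLimit (parallelPair f 0) (ev 𝒞 y ⋙ RightComod.shriek (𝒞.map α).toCoalgHom) :=
      preservesKernel_comp (ev 𝒞 y) _ f
    have : IsIso (Functor.whiskerLeft (parallelPair f 0) (shriekMapNatTrans α)) := by
      rw [NatTrans.isIso_iff_isIso_app]
      rintro (_ | _)
      exacts [hM α, hN α]
    exact isIso_app_conePt_of_preservesLimit (shriekMapNatTrans α) hk

theorem isCartesian_sub (hinj : IsSigmaInjectiveRep 𝒞) {M : TransComod 𝒞} (hM : IsCartesian 𝒞 M)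
    {p : ∀ x, Submodule K (M.obj x).carrier} (hp : IsStable M p)
    (h : ∀ ⦃x y : X⦄ (α : x ⟶ y), p x ≤ LinearMap.range
      ((RightComod.shriek _).map (RightComod.subι (hp.isStable_obj y)) ≫ M.shriekMap α).toLin) :
    IsCartesian 𝒞 (sub hp) := by
  intro x y α
  have hι (t) := RightComod.toLin_congr (shriekMap_naturality (subι hp) α) t
  refine RightComod.isIso_of_bijective _ ⟨?_, fun m => ?_⟩
  · have := (hinj α).shriek_preservesMonomorphisms
    have := hM α
    have : Mono (RightComod.subι (hp.isStable_obj y)) :=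
      (RightComod.mono_iff_injective _).2 (p y).injective_subtype
    exact Function.Injective.of_comp (f := (p x).subtype) <| (funext hι).subst <|
      (RightComod.mono_iff_injective _).1 <| mono_comp
        ((RightComod.shriek (𝒞.map α).toCoalgHom).map (RightComod.subι (hp.isStable_obj y)))
        (M.shriekMap α)
  · obtain ⟨t, ht⟩ := h α m.2
    exact ⟨t, Subtype.ext ((hι t).symm.trans ht)⟩

namespace Cartesian

instance : HasColimits (Cartesian 𝒞) where
  has_colimits_of_shape _ _ := inferInstance

instance : PreservesColimits (IsCartesian 𝒞).ι where
  preservesColimitsOfShape := inferInstance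

instance : HasFiniteBiproducts (Cartesian 𝒞) :=
  have : HasFiniteColimits (Cartesian 𝒞) := hasFiniteColimits_of_hasColimits _
  HasFiniteBiproducts.of_hasFiniteCoproducts

/-- The abelian structure on the category of cartesian trans-comodules over a `Σ`-injective
representation. -/
abbrev abelian (hinj : IsSigmaInjectiveRep 𝒞) : Abelian (Cartesian 𝒞) :=
  have := isClosedUnderKernels_isCartesian hinj
  have := (IsCartesian 𝒞).preservesKernels_ι
  have := hasFiniteProducts_of_hasFiniteBiproducts (C := Cartesian 𝒞)
  abelianOfReflectsIsomorphisms (IsCartesian 𝒞).ι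

theorem ab5OfSize (hinj : IsSigmaInjectiveRep 𝒞) : AB5OfSize.{u, u} (Cartesian 𝒞) :=
  have := isClosedUnderKernels_isCartesian hinj
  have := (IsCartesian 𝒞).preservesKernels_ι
  have := abelian hinj
  ab5OfSize_of_reflectsIsomorphisms (IsCartesian 𝒞).ι

end Cartesian

theorem IsCartesian.exists_seq_mem_range {M : TransComod 𝒞} (hM : IsCartesian 𝒞 M) {x y : X}
    (α : x ⟶ y) (m : (M.obj x).carrier) :
    ∃ d : ℕ → (M.obj y).carrier, ∀ (p : Submodule K (M.obj y).carrier)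
      (hp : RightComod.IsStable (M.obj y) p), (∀ n, d n ∈ p) → m ∈ LinearMap.range
        ((RightComod.shriek _).map (RightComod.subι hp) ≫ M.shriekMap α).toLin := by
  have := hM α
  obtain ⟨h, rfl⟩ := (ConcreteCategory.bijective_of_isIso
    ((RightComod.forgetMod K (𝒞.obj x)).map (M.shriekMap α))).2 m
  obtain ⟨T, hT, hh⟩ := RightComod.exists_finite_mem_range_shriek_map (M.obj y) h
  obtain ⟨d, hd⟩ := (hT.insert 0).countable.exists_eq_range ⟨_, Set.mem_insert _ _⟩
  refine ⟨d, fun p hp hdp => ?_⟩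
  obtain ⟨t, rfl⟩ := hh p hp ((Set.subset_insert 0 T).trans (hd ▸ Set.range_subset_iff.2 hdp))
  exact ⟨t, rfl⟩

theorem exists_isCartesian_sub (hinj : IsSigmaInjectiveRep 𝒞) {M : TransComod 𝒞}
    (hM : IsCartesian 𝒞 M) (g : ∀ x, (M.obj x).carrier) :
    ∃ (e : ∀ x, GenWord X x → (M.obj x).carrier)
      (h : IsStable M fun x => Submodule.span K (Set.range (e x))),
      IsCartesian 𝒞 (sub h) ∧ ∀ x, g x ∈ Set.range (e x) := by
  choose c hc using M.exists_seq_coact_mem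
  choose d hd using @hM.exists_seq_mem_range
  let e (x : X) : GenWord X x → (M.obj x).carrier := GenWord.eval g c d
  have he {x : X} (w : GenWord X x) : e x w ∈ Submodule.span K (Set.range (e x)) :=
    Submodule.subset_span ⟨w, rfl⟩
  have hstable : IsStable M fun x => Submodule.span K (Set.range (e x)) :=
    { isStable_obj := fun x => (Submodule.span_le (p :=
          (LinearMap.range (Submodule.subtype _ |>.rTensor _)).comap (M.obj x).coact)).2 <|
        Set.range_subset_iff.2 fun w => hc x (e x w) _ fun n => he (w.coact n)
      mapLin_mem := fun {x y} α => (Submodule.span_le (p :=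
          (Submodule.span K (Set.range (e x))).comap (M.mapLin α))).2 <|
        Set.range_subset_iff.2 fun w => he (w.map α) }
  refine ⟨e, hstable, isCartesian_sub hinj hM hstable fun x y α => ?_, fun x => ⟨.base x, rfl⟩⟩
  exact Submodule.span_le.2 <| Set.range_subset_iff.2 fun w =>
    hd α (e x w) _ (hstable.isStable_obj y) fun n => he (w.lift α n)

theorem exists_isCartesian_hom_mem_range (hinj : IsSigmaInjectiveRep 𝒞) {M : TransComod 𝒞}
    (hM : IsCartesian 𝒞 M) {x : X} (m : (M.obj x).carrier) :
    ∃ (N : TransComod 𝒞) (_ : IsCartesian 𝒞 N)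
      (q : ∀ y, (GenWord X y →₀ K) →ₗ[K] (N.obj y).carrier) (f : N ⟶ M),
      (∀ y, Function.Surjective (q y)) ∧ m ∈ LinearMap.range (f.app x).toLin := by
  classical
  obtain ⟨e, h, hcart, hm⟩ := exists_isCartesian_sub hinj hM (Pi.single x m)
  have he (y : X) (w : GenWord X y) : e y w ∈ Submodule.span K (Set.range (e y)) :=
    Submodule.subset_span ⟨w, rfl⟩
  refine ⟨sub h, hcart, fun y => Finsupp.linearCombination K fun w => ⟨e y w, he y w⟩, subι h,
    fun y => ?_, ⟨m, ?_⟩, rfl⟩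
  · rw [← LinearMap.range_eq_top, Finsupp.range_linearCombination]
    exact (Submodule.span_range_subtype_eq_top_iff _ (he y)).2 rfl
  · exact Submodule.subset_span (by simpa only [Pi.single_eq_same] using hm x)

theorem Cartesian.hasSeparator (hinj : IsSigmaInjectiveRep 𝒞) : HasSeparator (Cartesian 𝒞) := by
  let R : Type u := {r : Relations 𝒞 fun x => GenWord X x →₀ K // ∃ (P : Cartesian 𝒞)
    (q : ∀ x, (GenWord X x →₀ K) →ₗ[K] (P.obj.obj x).carrier),
    (∀ x, Function.Surjective (q x)) ∧ relations P.obj q = r}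
  choose P q hq hr using fun r : R => r.2
  refine ⟨∐ P, (isSeparator_sigma P).2 fun M N f f' hff' => ?_⟩
  refine ObjectProperty.hom_ext _ (hom_ext fun x => RightComod.hom_ext (LinearMap.ext fun m => ?_))
  obtain ⟨S, hS, q', g, hq', ⟨b, rfl⟩⟩ := exists_isCartesian_hom_mem_range hinj M.2 m
  let r : R := ⟨relations S q', ⟨S, hS⟩, q', hq', rfl⟩
  obtain ⟨k, hk⟩ := exists_hom_of_relations_eq (hq r) (hr r)
  obtain ⟨a, rfl⟩ := hq' x b
  have hkg : ObjectProperty.homMk (k ≫ g) ≫ f = ObjectProperty.homMk (k ≫ g) ≫ f' :=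
    hff' (P r) (ObjectProperty.ofObj_apply P r) _
  rw [← hk]
  exact LinearMap.congr_fun (congrArg (fun l => (Hom.app l.hom x).toLin) hkg) (q r x a)

end TransComod

theorem mainTheorem6_general {K : Type u} [Field K] {X : Type u} [Category.{u} X]
    (𝒞 : X ⥤ CoalgCat.{u} K) [IsQuasiFiniteRep 𝒞] (hinj : IsSigmaInjectiveRep 𝒞) :
    ∃ _ : Abelian (TransComod.Cartesian 𝒞),
      IsGrothendieckAbelian.{u} (TransComod.Cartesian 𝒞) := by
  let := TransComod.Cartesian.abelian hinj
  exact ⟨inferInstance,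
    { ab5OfSize := TransComod.Cartesian.ab5OfSize hinj
      hasSeparator := TransComod.Cartesian.hasSeparator hinj }⟩

end

theorem mainTheorem6 {K : Type u} [Field K] {X : Type u} [PartialOrder X]
    (𝒞 : X ⥤ CoalgCat.{u} K) [IsQuasiFiniteRep 𝒞] (hinj : IsSigmaInjectiveRep 𝒞)
    (hsp : ∀ x : X, RightComod.IsRightSemiperfect K (𝒞.obj x)) :
    ∃ _ : Abelian (TransComod.Cartesian 𝒞),
      IsGrothendieckAbelian.{u} (TransComod.Cartesian 𝒞) :=
  mainTheorem6_general 𝒞 hinj
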